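/- **Theorem (Grothendieck–Dolbeault lemma).** Let $E$ be a complex Banach space (for instance any finite-dimensional complex vector space), let $n\ge 0$, let $\mathcal O\subset\mathbb C^n$ be open, and let $\lambda$ be a $C^\infty$ differential form on $\mathcal O$ with values in $E$ which is pure of type $(r,s)$ with $r\ge 0$, $s\ge 1$. Here "pure of type $(r,s)$" means that $\lambda$ is a combination, with $C^\infty$ coefficients $\mathcal O\to E$, of exterior monomials of degree $r$ in $dz_1,\dots,dz_n$ and of degree $s$ in $d\bar z_1,\dots,d\bar z_n$; for such a form, $d\lambda=\partial\lambda+\bar\partial\lambda$ with $\partial\lambda$ pure of type $(r+1,s)$ and $\bar\partial\lambda=\sum_j d\bar z_j\wedge\partial\lambda/\partial\bar z_j$ pure of type $(r,s+1)$. The following conditions are equivalent: (i) $\bar\partial\lambda=0$ on $\mathcal O$; (ii) there are an open cover $(\mathcal O_\alpha)$ of $\mathcal O$ by subsets of $\mathcal O$ and, for every $\alpha$, a $C^\infty$ form $\mu_\alpha$ on $\mathcal O_\alpha$ with values in $E$, pure of type $(r,s-1)$, such that $\lambda|_{\mathcal O_\alpha}=\bar\partial\mu_\alpha$. -/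

import Mathlib

open scoped ContDiff

/-- The `2n` coordinate covectors on `ℂⁿ`: `Sum.inl i` stands for `dz_i`, the map `v ↦ v_i`, and
`Sum.inr j` stands for `dz̄_j`, the map `v ↦ conj v_j`. The space `ℂⁿ` is `Fin n → ℂ`; only its
vector space structure and its topology are used. -/
noncomputable def coordCovector {n : ℕ} : Fin n ⊕ Fin n → (Fin n → ℂ) →L[ℝ] ℂ
  | Sum.inl i => ContinuousLinearMap.proj i
  | Sum.inr j => Complex.conjCLE.toContinuousLinearMap.comp (ContinuousLinearMap.proj j)

/-- The exterior monomial `ζ_{K 0} ∧ ⋯ ∧ ζ_{K (p-1)}` in the coordinate covectors `ζ = dz_i, dz̄_j`: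
the complex-valued `p`-form `(v_0, …, v_{p-1}) ↦ det (ζ_{K a} (v_b))`. -/
noncomputable def wedgeMonomial {n p : ℕ} (K : Fin p → Fin n ⊕ Fin n) :
    (Fin n → ℂ) [⋀^Fin p]→L[ℝ] ℂ where
  toFun v := Matrix.det (Matrix.of fun a b => coordCovector (K a) (v b))
  map_update_add' {_} v i x y := by
    rename_i inst
    obtain rfl := Subsingleton.elim inst (instDecidableEqFin p)
    have key : ∀ z, (Matrix.of fun a b => coordCovector (K a) (Function.update v i z b)) =
        (Matrix.of fun a b => coordCovector (K a) (v b)).updateCol i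
          fun a => coordCovector (K a) z := by
      intro z
      ext a b
      by_cases h : b = i
      · subst h; simp
      · simp [h]
    rw [key, key, key, ← Matrix.det_updateCol_add]
    congr 2
    ext a
    simp
  map_update_smul' {_} v i c x := by
    rename_i inst
    obtain rfl := Subsingleton.elim inst (instDecidableEqFin p)
    have key : ∀ z, (Matrix.of fun a b => coordCovector (K a) (Function.update v i z b)) =
        (Matrix.of fun a b => coordCovector (K a) (v b)).updateCol i
          fun a => coordCovector (K a) z := by
      intro z
      ext a b
      by_cases h : b = i
      · subst h; simp
      · simp [h]
    rw [key, key, Complex.real_smul, ← Matrix.det_updateCol_smul]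
    congr 2
    ext a
    simp
  map_eq_zero_of_eq' v i j h hij := Matrix.det_zero_of_column_eq hij fun a => by simp [h]
  cont := by
    refine Continuous.matrix_det (A := fun v : Fin p → Fin n → ℂ =>
      Matrix.of fun a b => coordCovector (K a) (v b)) ?_
    refine continuous_matrix fun a b => ?_
    exact (coordCovector (K a)).continuous.comp (continuous_apply b)

theorem wedgeMonomial_apply {n p : ℕ} (K : Fin p → Fin n ⊕ Fin n) (v : Fin p → Fin n → ℂ) :
    wedgeMonomial K v = Matrix.det (Matrix.of fun a b => coordCovector (K a) (v b)) := rfl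

/-- The indices `K` of the monomials of degree `p` which have degree `r` in the `dz_i` and degree
`s` in the `dz̄_j`. -/
def bidegreeIndices (n p r s : ℕ) : Finset (Fin p → Fin n ⊕ Fin n) :=
  Finset.univ.filter fun K =>
    (Finset.univ.filter fun a => (K a).isLeft = true).card = r ∧
    (Finset.univ.filter fun a => (K a).isRight = true).card = s

/-- `η`, an `E`-valued differential form of degree `p`, is on `U` a `C^∞` form which is pure of type
`(r, s)`: it is a combination, with `C^∞` coefficients in `E`, of the monomials of degree `r` in the
`dz_i` and degree `s` in the `dz̄_j`. The values of `η` outside `U` play no role. -/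
def IsPureForm {n p : ℕ} {E : Type*} [NormedAddCommGroup E] [NormedSpace ℂ E] (r s : ℕ)
    (U : Set (Fin n → ℂ)) (η : (Fin n → ℂ) → (Fin n → ℂ) [⋀^Fin p]→L[ℝ] E) : Prop :=
  ∃ f : (Fin p → Fin n ⊕ Fin n) → (Fin n → ℂ) → E,
    (∀ K, ContDiffOn ℝ ∞ (f K) U) ∧
    ∀ x ∈ U, ∀ v, η x v = ∑ K ∈ bidegreeIndices n p r s, wedgeMonomial K v • f K x

/-- The complex-linear part `v ↦ (L v - i L (i v)) / 2` of a real-linear map `L`. -/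
noncomputable def linearPart {V F : Type*} [NormedAddCommGroup V] [NormedSpace ℂ V]
    [NormedAddCommGroup F] [NormedSpace ℂ F] (L : V →L[ℝ] F) : V →L[ℝ] F :=
  (1 / 2 : ℂ) • (L - Complex.I • L.comp (Complex.I • ContinuousLinearMap.id ℝ V))

/-- The complex-antilinear part `v ↦ (L v + i L (i v)) / 2` of a real-linear map `L`. -/
noncomputable def antilinearPart {V F : Type*} [NormedAddCommGroup V] [NormedSpace ℂ V]
    [NormedAddCommGroup F] [NormedSpace ℂ F] (L : V →L[ℝ] F) : V →L[ℝ] F :=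
  (1 / 2 : ℂ) • (L + Complex.I • L.comp (Complex.I • ContinuousLinearMap.id ℝ V))

/-- The operator `∂η = ∑ j, dz_j ∧ ∂η/∂z_j`: the same expression as the exterior derivative
`extDeriv η x = alternatizeUncurryFin (fderiv ℝ η x)`, with the complex-linear part of the
derivative. -/
noncomputable def del {n p : ℕ} {E : Type*} [NormedAddCommGroup E] [NormedSpace ℂ E]
    (η : (Fin n → ℂ) → (Fin n → ℂ) [⋀^Fin p]→L[ℝ] E) (x : Fin n → ℂ) :
    (Fin n → ℂ) [⋀^Fin (p + 1)]→L[ℝ] E :=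
  .alternatizeUncurryFin (linearPart (fderiv ℝ η x))

/-- The operator `∂̄η = ∑ j, dz̄_j ∧ ∂η/∂z̄_j`: the same expression as the exterior derivative
`extDeriv η x = alternatizeUncurryFin (fderiv ℝ η x)`, with the antilinear part of the derivative.
The facts `extDeriv_eq_del_add_delbar`, `IsPureForm.del` and `IsPureForm.delbar` below say that, on
forms pure of type `(r, s)`, `∂` and `∂̄` are the parts of `d` of types `(r + 1, s)` and
`(r, s + 1)`. -/
noncomputable def delbar {n p : ℕ} {E : Type*} [NormedAddCommGroup E] [NormedSpace ℂ E]
    (η : (Fin n → ℂ) → (Fin n → ℂ) [⋀^Fin p]→L[ℝ] E) (x : Fin n → ℂ) :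
    (Fin n → ℂ) [⋀^Fin (p + 1)]→L[ℝ] E :=
  .alternatizeUncurryFin (antilinearPart (fderiv ℝ η x))

theorem extDeriv_eq_del_add_delbar {n p : ℕ} {E : Type*} [NormedAddCommGroup E] [NormedSpace ℂ E]
    (η : (Fin n → ℂ) → (Fin n → ℂ) [⋀^Fin p]→L[ℝ] E) (x : Fin n → ℂ) :
    extDeriv η x = del η x + delbar η x := by
  rw [extDeriv, del, delbar, ← ContinuousAlternatingMap.alternatizeUncurryFin_add]
  congr 1
  ext1 w
  simp only [linearPart, antilinearPart, add_apply, smul_apply, sub_apply]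
  module

theorem wedgeMonomial_cons {n p : ℕ} (c : Fin n ⊕ Fin n) (K : Fin p → Fin n ⊕ Fin n)
    (v : Fin (p + 1) → Fin n → ℂ) :
    wedgeMonomial (Fin.cons c K : Fin (p + 1) → Fin n ⊕ Fin n) v =
      ∑ i : Fin (p + 1), (-1) ^ (i : ℕ) * coordCovector c (v i) * wedgeMonomial K (i.removeNth v) := by
  rw [wedgeMonomial_apply, Matrix.det_succ_row_zero]
  refine Finset.sum_congr rfl fun i _ => ?_
  rw [wedgeMonomial_apply]
  simp only [Matrix.of_apply, Fin.cons_zero]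
  rfl

/-- A form which is pure on `U` has a derivative on `U`, computed from that of its coefficients. -/
theorem fderiv_eq_of_pure {n p : ℕ} {E : Type*} [NormedAddCommGroup E] [NormedSpace ℂ E] {r s : ℕ}
    {U : Set (Fin n → ℂ)} (hU : IsOpen U) {η : (Fin n → ℂ) → (Fin n → ℂ) [⋀^Fin p]→L[ℝ] E}
    {f : (Fin p → Fin n ⊕ Fin n) → (Fin n → ℂ) → E} (hf : ∀ K, ContDiffOn ℝ ∞ (f K) U)
    (hη : ∀ x ∈ U, ∀ v, η x v = ∑ K ∈ bidegreeIndices n p r s, wedgeMonomial K v • f K x)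
    {x : Fin n → ℂ} (hx : x ∈ U) (w : Fin n → ℂ) (v : Fin p → Fin n → ℂ) :
    fderiv ℝ η x w v =
      ∑ K ∈ bidegreeIndices n p r s, wedgeMonomial K v • fderiv ℝ (f K) x w := by
  let A (K : Fin p → Fin n ⊕ Fin n) : E →L[ℝ] (Fin n → ℂ) [⋀^Fin p]→L[ℝ] E :=
    ((ContinuousLinearMap.compContinuousAlternatingMapCLM ℝ (Fin n → ℂ) ℂ E (Fin p)).flip
      (wedgeMonomial K)).comp (ContinuousLinearMap.lsmul ℝ ℂ : ℂ →L[ℝ] E →L[ℝ] E).flip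
  have hA : ∀ K e u, A K e u = wedgeMonomial K u • e := fun K e u => rfl
  have hev : η =ᶠ[nhds x] fun y => ∑ K ∈ bidegreeIndices n p r s, A K (f K y) := by
    filter_upwards [hU.mem_nhds hx] with y hy
    ext u
    simp [hη y hy u, hA, ContinuousAlternatingMap.sum_apply]
  have hd : HasFDerivAt (fun y => ∑ K ∈ bidegreeIndices n p r s, A K (f K y))
      (∑ K ∈ bidegreeIndices n p r s, (A K).comp (fderiv ℝ (f K) x)) x := by
    refine HasFDerivAt.fun_sum fun K _ => (A K).hasFDerivAt.comp x ?_
    exact (((hf K).contDiffAt (hU.mem_nhds hx)).differentiableAt (by simp)).hasFDerivAt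
  rw [hev.fderiv_eq, hd.fderiv]
  simp [hA, ContinuousAlternatingMap.sum_apply]

theorem linearPart_smul {V F : Type*} [NormedAddCommGroup V] [NormedSpace ℂ V]
    [NormedAddCommGroup F] [NormedSpace ℂ F] (L : V →L[ℝ] F) (c : ℂ) (w : V) :
    linearPart L (c • w) = c • linearPart L w := by
  have h : ∀ u : V, L (c • u) = c.re • L u + c.im • L (Complex.I • u) := by
    intro u
    rw [← map_smul, ← map_smul, ← map_add]
    congr 1
    conv_lhs => rw [← Complex.re_add_im c, add_smul, mul_smul]
    simp
  simp only [linearPart, smul_apply, sub_apply, ContinuousLinearMap.comp_apply,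
    ContinuousLinearMap.id_apply]
  rw [smul_comm Complex.I c w, h, h, smul_smul Complex.I Complex.I w, Complex.I_mul_I, neg_one_smul,
    map_neg]
  simp only [← Complex.coe_smul]
  conv_rhs => rw [← Complex.re_add_im c]
  match_scalars <;> (ring_nf; try simp [Complex.I_sq]; try ring)

theorem antilinearPart_smul {V F : Type*} [NormedAddCommGroup V] [NormedSpace ℂ V]
    [NormedAddCommGroup F] [NormedSpace ℂ F] (L : V →L[ℝ] F) (c : ℂ) (w : V) :
    antilinearPart L (c • w) = (starRingEnd ℂ) c • antilinearPart L w := by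
  have h : ∀ u : V, L (c • u) = c.re • L u + c.im • L (Complex.I • u) := by
    intro u
    rw [← map_smul, ← map_smul, ← map_add]
    congr 1
    conv_lhs => rw [← Complex.re_add_im c, add_smul, mul_smul]
    simp
  have hc : (starRingEnd ℂ) c = c.re - c.im * Complex.I := by
    apply Complex.ext <;> simp
  simp only [antilinearPart, smul_apply, add_apply, ContinuousLinearMap.comp_apply,
    ContinuousLinearMap.id_apply]
  rw [smul_comm Complex.I c w, h, h, smul_smul Complex.I Complex.I w, Complex.I_mul_I, neg_one_smul,
    map_neg, hc]
  simp only [← Complex.coe_smul]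
  match_scalars <;> (ring_nf; try simp [Complex.I_sq]; try ring)

theorem linearPart_apply_eq_sum {n : ℕ} {E : Type*} [NormedAddCommGroup E] [NormedSpace ℂ E]
    (L : (Fin n → ℂ) →L[ℝ] E) (w : Fin n → ℂ) :
    linearPart L w =
      ∑ j, coordCovector (Sum.inl j) w • linearPart L (Pi.single j (1 : ℂ)) := by
  conv_lhs => rw [pi_eq_sum_univ' w, map_sum]
  refine Finset.sum_congr rfl fun j _ => ?_
  rw [← linearPart_smul]
  congr 1

theorem antilinearPart_apply_eq_sum {n : ℕ} {E : Type*} [NormedAddCommGroup E] [NormedSpace ℂ E]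
    (L : (Fin n → ℂ) →L[ℝ] E) (w : Fin n → ℂ) :
    antilinearPart L w =
      ∑ j, coordCovector (Sum.inr j) w • antilinearPart L (Pi.single j (1 : ℂ)) := by
  conv_lhs => rw [pi_eq_sum_univ' w, map_sum]
  refine Finset.sum_congr rfl fun j _ => ?_
  have : coordCovector (Sum.inr j) w = (starRingEnd ℂ) (w j) := rfl
  rw [this, ← antilinearPart_smul]

theorem isPureForm_of_sum {n p : ℕ} {E : Type*} [NormedAddCommGroup E] [NormedSpace ℂ E]
    {r s r' s' : ℕ} {U : Set (Fin n → ℂ)}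
    {η : (Fin n → ℂ) → (Fin n → ℂ) [⋀^Fin (p + 1)]→L[ℝ] E} (c : Fin n → Fin n ⊕ Fin n)
    (hK : ∀ j, ∀ K : Fin p → Fin n ⊕ Fin n, K ∈ bidegreeIndices n p r s →
      (Fin.cons (c j) K : Fin (p + 1) → Fin n ⊕ Fin n) ∈ bidegreeIndices n (p + 1) r' s')
    (g : Fin n → (Fin p → Fin n ⊕ Fin n) → (Fin n → ℂ) → E)
    (hg : ∀ j K, ContDiffOn ℝ ∞ (g j K) U)
    (hη : ∀ x ∈ U, ∀ v, η x v = ∑ K ∈ bidegreeIndices n p r s, ∑ j,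
      wedgeMonomial (Fin.cons (c j) K : Fin (p + 1) → Fin n ⊕ Fin n) v • g j K x) :
    IsPureForm r' s' U η := by
  classical
  refine ⟨fun M x => ∑ K ∈ bidegreeIndices n p r s, ∑ j,
    if M = Fin.cons (c j) K then g j K x else 0, fun M => ?_, fun x hx v => ?_⟩
  · refine ContDiffOn.sum fun K _ => ContDiffOn.sum fun j _ => ?_
    split_ifs
    · exact hg j K
    · exact contDiffOn_const
  · rw [hη x hx v]
    simp_rw [Finset.smul_sum]
    symm
    rw [Finset.sum_comm]
    refine Finset.sum_congr rfl fun K hKm => ?_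
    rw [Finset.sum_comm]
    refine Finset.sum_congr rfl fun j _ => ?_
    simp [hK j K hKm]

theorem IsPureForm.del {n p : ℕ} {E : Type*} [NormedAddCommGroup E] [NormedSpace ℂ E] {r s : ℕ}
    {U : Set (Fin n → ℂ)} (hU : IsOpen U) {η : (Fin n → ℂ) → (Fin n → ℂ) [⋀^Fin p]→L[ℝ] E}
    (h : IsPureForm r s U η) : IsPureForm (r + 1) s U (_root_.del η) := by
  obtain ⟨f, hf, hη⟩ := h
  have hd : ∀ K, ContDiffOn ℝ ∞ (fun x => fderiv ℝ (f K) x) U := fun K =>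
    (hf K).fderiv_of_isOpen hU (by simp)
  refine isPureForm_of_sum (r := r) (s := s) Sum.inl (fun j K hK => ?_)
    (fun j K x => linearPart (fderiv ℝ (f K) x) (Pi.single j (1 : ℂ))) (fun j K => ?_)
    (fun x hx v => ?_)
  · simp only [bidegreeIndices, Finset.mem_filter, Finset.mem_univ, true_and,
      Fin.card_filter_univ_succ] at hK ⊢
    simp [hK.1, hK.2]
  · simp only [linearPart, smul_apply, sub_apply, ContinuousLinearMap.comp_apply]
    exact (((hd K).clm_apply contDiffOn_const).sub
      (((hd K).clm_apply contDiffOn_const).const_smul _)).const_smul _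
  · rw [_root_.del, ContinuousAlternatingMap.alternatizeUncurryFin_apply]
    have key : ∀ (w : Fin n → ℂ) (u : Fin p → Fin n → ℂ), linearPart (fderiv ℝ η x) w u =
        ∑ K ∈ bidegreeIndices n p r s, wedgeMonomial K u • linearPart (fderiv ℝ (f K) x) w := by
      intro w u
      simp only [linearPart, smul_apply, sub_apply, ContinuousLinearMap.comp_apply,
        ContinuousAlternatingMap.smul_apply, ContinuousAlternatingMap.sub_apply,
        fderiv_eq_of_pure hU hf hη hx, Finset.smul_sum, ← Finset.sum_sub_distrib]
      refine Finset.sum_congr rfl fun K _ => ?_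
      module
    simp only [key, wedgeMonomial_cons, Finset.smul_sum, Finset.sum_smul]
    rw [Finset.sum_comm]
    refine Finset.sum_congr rfl fun K _ => ?_
    rw [Finset.sum_comm]
    refine Finset.sum_congr rfl fun i _ => ?_
    rw [linearPart_apply_eq_sum, Finset.smul_sum, Finset.smul_sum]
    refine Finset.sum_congr rfl fun j _ => ?_
    rw [← Int.cast_smul_eq_zsmul ℂ, smul_smul, smul_smul]
    push_cast
    ring_nf

theorem IsPureForm.delbar {n p : ℕ} {E : Type*} [NormedAddCommGroup E] [NormedSpace ℂ E] {r s : ℕ}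
    {U : Set (Fin n → ℂ)} (hU : IsOpen U) {η : (Fin n → ℂ) → (Fin n → ℂ) [⋀^Fin p]→L[ℝ] E}
    (h : IsPureForm r s U η) : IsPureForm r (s + 1) U (_root_.delbar η) := by
  obtain ⟨f, hf, hη⟩ := h
  have hd : ∀ K, ContDiffOn ℝ ∞ (fun x => fderiv ℝ (f K) x) U := fun K =>
    (hf K).fderiv_of_isOpen hU (by simp)
  refine isPureForm_of_sum (r := r) (s := s) Sum.inr (fun j K hK => ?_)
    (fun j K x => antilinearPart (fderiv ℝ (f K) x) (Pi.single j (1 : ℂ))) (fun j K => ?_)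
    (fun x hx v => ?_)
  · simp only [bidegreeIndices, Finset.mem_filter, Finset.mem_univ, true_and,
      Fin.card_filter_univ_succ] at hK ⊢
    simp [hK.1, hK.2]
  · simp only [antilinearPart, smul_apply, add_apply, ContinuousLinearMap.comp_apply]
    exact (((hd K).clm_apply contDiffOn_const).add
      (((hd K).clm_apply contDiffOn_const).const_smul _)).const_smul _
  · rw [_root_.delbar, ContinuousAlternatingMap.alternatizeUncurryFin_apply]
    have key : ∀ (w : Fin n → ℂ) (u : Fin p → Fin n → ℂ), antilinearPart (fderiv ℝ η x) w u =
        ∑ K ∈ bidegreeIndices n p r s, wedgeMonomial K u • antilinearPart (fderiv ℝ (f K) x) w := by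
      intro w u
      simp only [antilinearPart, smul_apply, add_apply, ContinuousLinearMap.comp_apply,
        ContinuousAlternatingMap.smul_apply, ContinuousAlternatingMap.add_apply,
        fderiv_eq_of_pure hU hf hη hx, Finset.smul_sum, ← Finset.sum_add_distrib]
      refine Finset.sum_congr rfl fun K _ => ?_
      module
    simp only [key, wedgeMonomial_cons, Finset.smul_sum, Finset.sum_smul]
    rw [Finset.sum_comm]
    refine Finset.sum_congr rfl fun K _ => ?_
    rw [Finset.sum_comm]
    refine Finset.sum_congr rfl fun i _ => ?_
    rw [antilinearPart_apply_eq_sum, Finset.smul_sum, Finset.smul_sum]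
    refine Finset.sum_congr rfl fun j _ => ?_
    rw [← Int.cast_smul_eq_zsmul ℂ, smul_smul, smul_smul]
    push_cast
    ring_nf

/-!
One removes the differentials `dz̄_k` one variable at a time. By the Cauchy–Pompeiu formula, the
Cauchy transform `T` along the `k`-th axis inverts `∂/∂z̄_k` on compactly supported functions.
Therefore, with `ι` the contraction with `∂/∂z̄_k`, the form `η - ∂̄ (T (χ · ι η))` does not contain
`dz̄_k` where the cutoff `χ` is `1`. If `η` is closed and contains no `dz̄_j`, then the coefficients
of `ι η` are holomorphic in `z_j`, and the correction brings no `dz̄_j` back provided that `χ` is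
locally constant in `z_j` along the axis. What remains after the last variable is a form of type
`(r, s)` without any `dz̄_k`, which vanishes as `s ≥ 1`.
-/

section AntilinearPart

variable {V F G : Type*} [NormedAddCommGroup V] [NormedSpace ℂ V] [NormedAddCommGroup F]
  [NormedSpace ℂ F] [NormedAddCommGroup G] [NormedSpace ℂ G]

theorem antilinearPart_apply (L : V →L[ℝ] F) (w : V) :
    antilinearPart L w = (1 / 2 : ℂ) • (L w + Complex.I • L (Complex.I • w)) := rfl

theorem antilinearPart_apply_eq_zero_iff {L : V →L[ℝ] F} {w : V} :
    antilinearPart L w = 0 ↔ L (Complex.I • w) = Complex.I • L w := by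
  rw [antilinearPart_apply, smul_eq_zero_iff_right (by norm_num), add_eq_zero_iff_eq_neg,
    ← smul_right_inj Complex.I_ne_zero, smul_neg, smul_smul, Complex.I_mul_I, neg_one_smul, neg_neg,
    eq_comm]

theorem map_complex_smul_of_antilinearPart_eq_zero {L : V →L[ℝ] F} (hL : antilinearPart L = 0)
    (c : ℂ) (w : V) : L (c • w) = c • L w := by
  have eq_linearPart : L = linearPart L := by
    have add_eq : L = linearPart L + antilinearPart L := by
      ext w
      simp only [linearPart, antilinearPart, add_apply, smul_apply, sub_apply]
      module
    rwa [hL, add_zero] at add_eq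
  rw [eq_linearPart, linearPart_smul]

/-- The map `L ↦ antilinearPart L` as a complex-linear continuous map. -/
noncomputable def antilinearPartCLM (V F : Type*) [NormedAddCommGroup V] [NormedSpace ℂ V]
    [NormedAddCommGroup F] [NormedSpace ℂ F] : (V →L[ℝ] F) →L[ℂ] V →L[ℝ] F where
  toFun := antilinearPart
  map_add' L M := by
    ext w
    simp only [antilinearPart_apply, add_apply]
    module
  map_smul' c L := by
    ext w
    simp only [antilinearPart_apply, smul_apply, RingHom.id_apply]
    module
  cont := by
    have cont_comp : Continuous fun L : V →L[ℝ] F => L.comp (Complex.I • .id ℝ V) :=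
      (ContinuousLinearMap.precomp F (Complex.I • ContinuousLinearMap.id ℝ V)).continuous
    exact (continuous_id.add (cont_comp.const_smul Complex.I)).const_smul (1 / 2 : ℂ)

theorem antilinearPartCLM_apply (L : V →L[ℝ] F) : antilinearPartCLM V F L = antilinearPart L := rfl

theorem antilinearPart_restrictScalars_comp (A : F →L[ℂ] G) (L : V →L[ℝ] F) :
    antilinearPart ((A.restrictScalars ℝ).comp L) =
      (A.restrictScalars ℝ).comp (antilinearPart L) := by
  ext w
  simp only [antilinearPart_apply, ContinuousLinearMap.comp_apply,
    ContinuousLinearMap.coe_restrictScalars', map_smul, map_add]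

/-- The derivative of `g` at `z` along `w` in the antiholomorphic sense: for `w` the `k`-th vector
of the standard basis of `ℂⁿ` this is `∂g/∂z̄_k`. -/
noncomputable def conjDeriv (w : V) (g : V → F) (z : V) : F :=
  antilinearPart (fderiv ℝ g z) w

theorem conjDeriv_clm_comp (A : F →L[ℂ] G) {g : V → F} {z : V} (hg : DifferentiableAt ℝ g z)
    (w : V) : conjDeriv w (fun y => A (g y)) z = A (conjDeriv w g z) := by
  have h : fderiv ℝ (fun y => A (g y)) z = (A.restrictScalars ℝ).comp (fderiv ℝ g z) :=
    ((A.restrictScalars ℝ).hasFDerivAt.comp z hg.hasFDerivAt).fderiv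
  rw [conjDeriv, h, antilinearPart_restrictScalars_comp]
  rfl

end AntilinearPart

section Contraction

variable {V F : Type*} [NormedAddCommGroup V] [NormedSpace ℂ V] [NormedAddCommGroup F]
  [NormedSpace ℂ F] {p : ℕ}

/-- The `F`-valued real `p`-forms on `V` which are complex-linear along the line `ℂw` in each of
their arguments. On `ℂⁿ`, with `w` the `k`-th vector of the standard basis, these are the forms
without `dz̄_k`. -/
def formsLinearAlong (w : V) : Submodule ℂ (V [⋀^Fin p]→L[ℝ] F) where
  carrier := {α | ∀ (v : Fin p → V) (i : Fin p),
    α (Function.update v i (Complex.I • w)) = Complex.I • α (Function.update v i w)}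
  add_mem' hα hβ v i := by
    simp only [ContinuousAlternatingMap.add_apply, hα v i, hβ v i, smul_add]
  zero_mem' _ _ := (smul_zero Complex.I).symm
  smul_mem' c α hα v i := by
    simp only [ContinuousAlternatingMap.smul_apply, hα v i, smul_comm c Complex.I]

theorem mem_formsLinearAlong_iff_cons {w : V} {α : V [⋀^Fin (p + 1)]→L[ℝ] F} :
    α ∈ formsLinearAlong w ↔ ∀ v : Fin p → V,
      α (Fin.cons (Complex.I • w) v) = Complex.I • α (Fin.cons w v) := by
  refine ⟨fun h v => ?_, fun h v i => ?_⟩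
  · simpa only [Fin.update_cons_zero] using h (Fin.cons 0 v) 0
  · rw [← Fin.insertNth_removeNth, ← Fin.insertNth_removeNth, α.map_insertNth, α.map_insertNth,
      smul_comm Complex.I]
    exact congrArg _ (h _)

/-- The contraction of a form with the antiholomorphic part of the constant vector field `w`; for
`w` the `k`-th vector of the standard basis of `ℂⁿ`, this is the contraction with `∂/∂z̄_k`. -/
noncomputable def contractBar (w : V) : (V [⋀^Fin (p + 1)]→L[ℝ] F) →L[ℂ] V [⋀^Fin p]→L[ℝ] F where
  toFun α := antilinearPart α.curryLeft w
  map_add' α β := congrArg (· w) ((antilinearPartCLM V _).map_add α.curryLeft β.curryLeft)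
  map_smul' c α := congrArg (· w) ((antilinearPartCLM V _).map_smul c α.curryLeft)
  cont := by
    have cont_curry : Continuous fun α : V [⋀^Fin (p + 1)]→L[ℝ] F => α.curryLeft :=
      ContinuousAlternatingMap.curryLeftLI.continuous
    exact ((antilinearPartCLM V _).continuous.comp cont_curry).clm_apply continuous_const

theorem contractBar_apply (w : V) (α : V [⋀^Fin (p + 1)]→L[ℝ] F) (v : Fin p → V) :
    contractBar w α v = (1 / 2 : ℂ) •
      (α (Fin.cons w v) + Complex.I • α (Fin.cons (Complex.I • w) v)) := rfl

theorem contractBar_eq_zero_iff {w : V} {α : V [⋀^Fin (p + 1)]→L[ℝ] F} :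
    contractBar w α = 0 ↔ α ∈ formsLinearAlong w := by
  rw [mem_formsLinearAlong_iff_cons]
  exact (antilinearPart_apply_eq_zero_iff (L := α.curryLeft)).trans ContinuousAlternatingMap.ext_iff

theorem contractBar_mem_formsLinearAlong {w u : V} {α : V [⋀^Fin (p + 1)]→L[ℝ] F}
    (h : α ∈ formsLinearAlong w) : contractBar u α ∈ formsLinearAlong w := by
  intro v i
  simp only [contractBar_apply, Fin.cons_update, h _ _]
  module

theorem alternatingMap_cons_cons_swap (α : V [⋀^Fin (p + 2)]→L[ℝ] F) (a b : V) (v : Fin p → V) :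
    α (Fin.cons a (Fin.cons b v : Fin (p + 1) → V)) =
      -α (Fin.cons b (Fin.cons a v : Fin (p + 1) → V)) := by
  rw [← α.coe_toAlternatingMap, ← α.toAlternatingMap.map_swap _ (Fin.zero_ne_one (n := p))]
  congr 1
  refine funext (Fin.cases rfl (Fin.cases rfl fun i => ?_))
  have ne_one : i.succ.succ ≠ (1 : Fin (p + 2)) := (Fin.succ_injective _).ne (Fin.succ_ne_zero i)
  rw [Function.comp_apply, Equiv.swap_apply_of_ne_of_ne (Fin.succ_ne_zero _) ne_one]
  rfl

theorem alternatingMap_cons_cons_self (α : V [⋀^Fin (p + 2)]→L[ℝ] F) (a : V) (v : Fin p → V) :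
    α (Fin.cons a (Fin.cons a v : Fin (p + 1) → V)) = 0 :=
  α.map_eq_zero_of_eq _ (i := 0) (j := 1) rfl Fin.zero_ne_one

theorem contractBar_self_mem_formsLinearAlong (w : V) (α : V [⋀^Fin (p + 1)]→L[ℝ] F) :
    contractBar w α ∈ formsLinearAlong w := by
  cases p with
  | zero => exact fun _ i => i.elim0
  | succ p =>
    refine mem_formsLinearAlong_iff_cons.2 fun v => ?_
    simp only [contractBar_apply, alternatingMap_cons_cons_self,
      alternatingMap_cons_cons_swap α (Complex.I • w) w]
    match_scalars
    linear_combination (1 / 2 : ℂ) * Complex.I_mul_I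

theorem contractBar_alternatizeUncurryFin {w : V} {L : V →L[ℝ] V [⋀^Fin p]→L[ℝ] F}
    (hL : L (Complex.I • w) = -Complex.I • L w) (h : ∀ u, L u ∈ formsLinearAlong w) :
    contractBar w (.alternatizeUncurryFin L) = L w := by
  ext v
  have tail_term (i : Fin p) :
      L (v i) (i.succ.removeNth (Fin.cons (Complex.I • w) v : Fin (p + 1) → V)) =
        Complex.I • L (v i) (i.succ.removeNth (Fin.cons w v : Fin (p + 1) → V)) := by
    cases p with
    | zero => exact i.elim0
    | succ p =>
      have removeNth_succ_cons (u : V) : i.succ.removeNth (Fin.cons u v : Fin (p + 2) → V) =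
          (Fin.cons u (i.removeNth v) : Fin (p + 1) → V) := Fin.cons_comp_succ_succAbove u v i
      rw [removeNth_succ_cons, removeNth_succ_cons]
      exact mem_formsLinearAlong_iff_cons.1 (h (v i)) _
  simp only [contractBar_apply, ContinuousAlternatingMap.alternatizeUncurryFin_apply,
    Fin.sum_univ_succ, Fin.cons_zero, Fin.cons_succ, tail_term, hL, Fin.removeNth_zero,
    Fin.tail_cons, ContinuousAlternatingMap.smul_apply, smul_add, Finset.smul_sum,
    Fin.val_zero, pow_zero, one_smul]
  have tail_cancel (c : ℤ) (y : F) :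
      (1 / 2 : ℂ) • Complex.I • c • Complex.I • y = -((1 / 2 : ℂ) • c • y) := by
    rw [smul_comm c Complex.I, smul_smul Complex.I Complex.I, Complex.I_mul_I, neg_one_smul,
      smul_neg]
  simp only [tail_cancel, Finset.sum_neg_distrib]
  rw [smul_smul Complex.I, mul_neg, Complex.I_mul_I, neg_neg, one_smul]
  module

theorem fderiv_apply_mem_formsLinearAlong {W : Type*} [NormedAddCommGroup W] [NormedSpace ℝ W]
    {w : V} {η : W → V [⋀^Fin p]→L[ℝ] F} {x : W} (hη : DifferentiableAt ℝ η x)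
    (h : ∀ᶠ y in nhds x, η y ∈ formsLinearAlong w) (u : W) :
    fderiv ℝ η x u ∈ formsLinearAlong w := by
  cases p with
  | zero => exact fun _ i => i.elim0
  | succ p =>
    have contract_eq : (fun y => contractBar w (η y)) =ᶠ[nhds x] fun _ => 0 :=
      h.mono fun y hy => contractBar_eq_zero_iff.2 hy
    let A : V [⋀^Fin (p + 1)]→L[ℝ] F →L[ℝ] V [⋀^Fin p]→L[ℝ] F :=
      (contractBar w).restrictScalars ℝ
    have contract_deriv : A.comp (fderiv ℝ η x) = 0 := by
      rw [← (A.hasFDerivAt.comp x hη.hasFDerivAt).fderiv]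
      exact contract_eq.fderiv_eq.trans (fderiv_const_apply 0)
    exact contractBar_eq_zero_iff.1 (congrArg (· u) contract_deriv)

theorem antilinearPart_apply_mem_formsLinearAlong {W : Type*} [NormedAddCommGroup W]
    [NormedSpace ℂ W] {w : V} {L : W →L[ℝ] V [⋀^Fin p]→L[ℝ] F}
    (h : ∀ u, L u ∈ formsLinearAlong w) (u : W) : antilinearPart L u ∈ formsLinearAlong w :=
  Submodule.smul_mem _ _ (add_mem (h _) (Submodule.smul_mem _ _ (h _)))

end Contraction

section Delbar

variable {n p : ℕ} {E : Type*} [NormedAddCommGroup E] [NormedSpace ℂ E]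
  {η θ : (Fin n → ℂ) → (Fin n → ℂ) [⋀^Fin p]→L[ℝ] E} {x : Fin n → ℂ}

theorem delbar_congr (h : η =ᶠ[nhds x] θ) : delbar η x = delbar θ x := by
  rw [delbar, delbar, h.fderiv_eq]

theorem delbar_add (hη : DifferentiableAt ℝ η x) (hθ : DifferentiableAt ℝ θ x) :
    delbar (fun y => η y + θ y) x = delbar η x + delbar θ x := by
  rw [delbar, fderiv_fun_add hη hθ, ← antilinearPartCLM_apply, map_add,
    ContinuousAlternatingMap.alternatizeUncurryFin_add]
  rfl

theorem delbar_sub (hη : DifferentiableAt ℝ η x) (hθ : DifferentiableAt ℝ θ x) :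
    delbar (fun y => η y - θ y) x = delbar η x - delbar θ x := by
  have := delbar_add (η := fun y => η y - θ y) (hη.sub hθ) hθ
  simp only [sub_add_cancel] at this
  exact eq_sub_of_add_eq this.symm

theorem contractBar_delbar {w : Fin n → ℂ} (hη : DifferentiableAt ℝ η x)
    (h : ∀ᶠ y in nhds x, η y ∈ formsLinearAlong w) :
    contractBar w (delbar η x) = conjDeriv w η x :=
  contractBar_alternatizeUncurryFin (by rw [antilinearPart_smul, Complex.conj_I])
    (antilinearPart_apply_mem_formsLinearAlong (fderiv_apply_mem_formsLinearAlong hη h))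

theorem delbar_delbar (h : ContDiffAt ℝ 2 η x) : delbar (delbar η) x = 0 := by
  have symm_snd (v w : Fin n → ℂ) :
      fderiv ℝ (fderiv ℝ η) x v w = fderiv ℝ (fderiv ℝ η) x w v :=
    h.isSymmSndFDerivAt (by simp only [minSmoothness_of_isRCLikeNormedField, le_refl]) v w
  let A : ((Fin n → ℂ) →L[ℝ] (Fin n → ℂ) [⋀^Fin p]→L[ℝ] E) →L[ℂ]
      (Fin n → ℂ) [⋀^Fin (p + 1)]→L[ℝ] E :=
    { toFun := .alternatizeUncurryFin
      map_add' := ContinuousAlternatingMap.alternatizeUncurryFin_add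
      map_smul' := ContinuousAlternatingMap.alternatizeUncurryFin_smul
      cont := (ContinuousAlternatingMap.alternatizeUncurryFinCLM ℝ (Fin n → ℂ) E).continuous }
  have diff_fderiv : DifferentiableAt ℝ (fderiv ℝ η) x :=
    (h.fderiv_right (m := 1) le_rfl).differentiableAt one_ne_zero
  have fderiv_delbar : fderiv ℝ (delbar η) x =
      ((A.comp (antilinearPartCLM _ _)).restrictScalars ℝ).comp (fderiv ℝ (fderiv ℝ η) x) :=
    (((A.comp (antilinearPartCLM _ _)).restrictScalars ℝ).hasFDerivAt.comp x
      diff_fderiv.hasFDerivAt).fderiv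
  rw [delbar, fderiv_delbar, antilinearPart_restrictScalars_comp]
  refine ContinuousAlternatingMap.alternatizeUncurryFin_alternatizeUncurryFinCLM_comp_of_symmetric
    (f := ((antilinearPartCLM _ _).restrictScalars ℝ).comp
      (antilinearPart (fderiv ℝ (fderiv ℝ η) x)))
    fun v w => ?_
  simp only [antilinearPart_apply, ContinuousLinearMap.comp_apply, antilinearPartCLM_apply,
    ContinuousLinearMap.coe_restrictScalars', smul_apply, add_apply]
  rw [symm_snd w v, symm_snd (Complex.I • w) v, symm_snd w (Complex.I • v),
    symm_snd (Complex.I • w) (Complex.I • v)]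
  module

end Delbar

section PureForms

variable {n p : ℕ} {E : Type*} [NormedAddCommGroup E] [NormedSpace ℂ E] {r s : ℕ}

/-- The `E`-valued form `wedgeMonomial K ⊗ e`, as a function of the coefficient `e`. -/
noncomputable def wedgeMonomialSmul (K : Fin p → Fin n ⊕ Fin n) :
    E →L[ℂ] (Fin n → ℂ) [⋀^Fin p]→L[ℝ] E where
  toFun e :=
    ((ContinuousLinearMap.lsmul ℝ ℂ).flip e).compContinuousAlternatingMap (wedgeMonomial K)
  map_add' e e' := by
    ext v
    exact smul_add _ _ _
  map_smul' c e := by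
    ext v
    exact smul_comm _ _ _
  cont := (((ContinuousLinearMap.compContinuousAlternatingMapCLM ℝ (Fin n → ℂ) ℂ E (Fin p)).flip
    (wedgeMonomial K)).comp (ContinuousLinearMap.lsmul ℝ ℂ : ℂ →L[ℝ] E →L[ℝ] E).flip).continuous

theorem wedgeMonomialSmul_apply (K : Fin p → Fin n ⊕ Fin n) (e : E) (v : Fin p → Fin n → ℂ) :
    wedgeMonomialSmul K e v = wedgeMonomial K v • e := rfl

variable (n p E r s) in
/-- The form of type `(r, s)` with given coefficients, as a function of the family of its
coefficients. The form does not determine this family: the coefficients of monomials of another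
type are ignored, and the monomials of type `(r, s)` are linearly dependent. -/
noncomputable def pureFormOfCoeff :
    ((Fin p → Fin n ⊕ Fin n) → E) →L[ℂ] (Fin n → ℂ) [⋀^Fin p]→L[ℝ] E :=
  ∑ K ∈ bidegreeIndices n p r s, (wedgeMonomialSmul K).comp (ContinuousLinearMap.proj K)

theorem pureFormOfCoeff_apply (c : (Fin p → Fin n ⊕ Fin n) → E) :
    pureFormOfCoeff n p E r s c = ∑ K ∈ bidegreeIndices n p r s, wedgeMonomialSmul K (c K) := by
  simp only [pureFormOfCoeff, sum_apply, ContinuousLinearMap.comp_apply,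
    ContinuousLinearMap.proj_apply]

theorem pureFormOfCoeff_apply_apply (c : (Fin p → Fin n ⊕ Fin n) → E) (v : Fin p → Fin n → ℂ) :
    pureFormOfCoeff n p E r s c v = ∑ K ∈ bidegreeIndices n p r s, wedgeMonomial K v • c K := by
  simp only [pureFormOfCoeff_apply, ContinuousAlternatingMap.sum_apply, wedgeMonomialSmul_apply]

variable {U W : Set (Fin n → ℂ)} {η θ : (Fin n → ℂ) → (Fin n → ℂ) [⋀^Fin p]→L[ℝ] E}

theorem isPureForm_iff_exists_coeff : IsPureForm r s U η ↔
    ∃ f : (Fin n → ℂ) → (Fin p → Fin n ⊕ Fin n) → E,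
      ContDiffOn ℝ ∞ f U ∧ ∀ x ∈ U, η x = pureFormOfCoeff n p E r s (f x) := by
  refine ⟨fun ⟨f, hf, hη⟩ => ⟨fun x K => f K x, contDiffOn_pi.2 hf, fun x hx => ?_⟩,
    fun ⟨f, hf, hη⟩ => ⟨fun K x => f x K, contDiffOn_pi.1 hf, fun x hx v => ?_⟩⟩
  · ext v
    rw [hη x hx, pureFormOfCoeff_apply_apply]
  · rw [hη x hx, pureFormOfCoeff_apply_apply]

theorem IsPureForm.mono (h : IsPureForm r s U η) (hW : W ⊆ U) : IsPureForm r s W η :=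
  let ⟨f, hf, hη⟩ := h
  ⟨f, fun K => (hf K).mono hW, fun x hx => hη x (hW hx)⟩

theorem IsPureForm.congr (h : IsPureForm r s U η) (hθ : ∀ x ∈ U, θ x = η x) :
    IsPureForm r s U θ :=
  let ⟨f, hf, hη⟩ := h
  ⟨f, hf, fun x hx => hθ x hx ▸ hη x hx⟩

theorem IsPureForm.zero : IsPureForm r s U (0 : (Fin n → ℂ) → (Fin n → ℂ) [⋀^Fin p]→L[ℝ] E) :=
  isPureForm_iff_exists_coeff.2 ⟨0, contDiffOn_const, fun _ _ => (map_zero _).symm⟩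

theorem IsPureForm.add (hη : IsPureForm r s U η) (hθ : IsPureForm r s U θ) :
    IsPureForm r s U (η + θ) := by
  obtain ⟨f, hf, hηf⟩ := isPureForm_iff_exists_coeff.1 hη
  obtain ⟨g, hg, hθg⟩ := isPureForm_iff_exists_coeff.1 hθ
  exact isPureForm_iff_exists_coeff.2 ⟨f + g, hf.add hg, fun x hx => by
    simp only [Pi.add_apply, hηf x hx, hθg x hx, map_add]⟩

theorem IsPureForm.sub (hη : IsPureForm r s U η) (hθ : IsPureForm r s U θ) :
    IsPureForm r s U (η - θ) := by
  obtain ⟨f, hf, hηf⟩ := isPureForm_iff_exists_coeff.1 hη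
  obtain ⟨g, hg, hθg⟩ := isPureForm_iff_exists_coeff.1 hθ
  exact isPureForm_iff_exists_coeff.2 ⟨f - g, hf.sub hg, fun x hx => by
    simp only [Pi.sub_apply, hηf x hx, hθg x hx, map_sub]⟩

theorem IsPureForm.sum {ι : Type*} {t : Finset ι}
    {η : ι → (Fin n → ℂ) → (Fin n → ℂ) [⋀^Fin p]→L[ℝ] E} (h : ∀ i ∈ t, IsPureForm r s U (η i)) :
    IsPureForm r s U (∑ i ∈ t, η i) :=
  Finset.sum_induction η (IsPureForm r s U) (fun _ _ => .add) .zero h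

theorem isPureForm_wedgeMonomialSmul {K : Fin p → Fin n ⊕ Fin n} (hK : K ∈ bidegreeIndices n p r s)
    {g : (Fin n → ℂ) → E} (hg : ContDiffOn ℝ ∞ g U) :
    IsPureForm r s U (fun x => wedgeMonomialSmul K (g x)) := by
  classical
  refine ⟨fun M x => if M = K then g x else 0, fun M => ?_, fun x _ v => ?_⟩
  · beta_reduce
    split_ifs
    exacts [hg, contDiffOn_const]
  · simp only [smul_ite, smul_zero, Finset.sum_ite_eq', hK, if_true, wedgeMonomialSmul_apply]

theorem IsPureForm.contDiffOn (h : IsPureForm r s U η) : ContDiffOn ℝ ∞ η U := by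
  obtain ⟨f, hf, hη⟩ := isPureForm_iff_exists_coeff.1 h
  exact (((pureFormOfCoeff n p E r s).restrictScalars ℝ).contDiff.comp_contDiffOn hf).congr hη

theorem wedgeMonomial_cons_apply (K : Fin (p + 1) → Fin n ⊕ Fin n) (w : Fin n → ℂ)
    (v : Fin p → Fin n → ℂ) :
    wedgeMonomial K (Fin.cons w v) = ∑ a : Fin (p + 1),
      (-1) ^ (a : ℕ) * coordCovector (K a) w * wedgeMonomial (K ∘ a.succAbove) v :=
  Matrix.det_succ_column_zero _

theorem antilinearPart_coordCovector_single (c : Fin n ⊕ Fin n) (k : Fin n) :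
    antilinearPart (coordCovector c) (Pi.single k 1) = if c = Sum.inr k then 1 else 0 := by
  rcases c with i | i
  · rw [if_neg Sum.inl_ne_inr, antilinearPart_apply_eq_zero_iff]
    rfl
  · have coord_I_smul : coordCovector (Sum.inr i) (Complex.I • Pi.single k (1 : ℂ)) =
        -Complex.I * coordCovector (Sum.inr i) (Pi.single k (1 : ℂ)) :=
      (map_mul (starRingEnd ℂ) _ _).trans (by rw [Complex.conj_I]; rfl)
    have coord_single : coordCovector (Sum.inr i) (Pi.single k (1 : ℂ)) =
        if i = k then 1 else 0 := by
      change (starRingEnd ℂ) ((Pi.single k 1 : Fin n → ℂ) i) = _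
      rw [Pi.single_apply, apply_ite (starRingEnd ℂ), map_one, map_zero]
    rw [antilinearPart_apply, coord_I_smul, smul_eq_mul, smul_eq_mul, neg_mul, mul_neg,
      ← mul_assoc, Complex.I_mul_I, coord_single]
    simp only [Sum.inr.injEq]
    ring

theorem contractBar_wedgeMonomialSmul (K : Fin (p + 1) → Fin n ⊕ Fin n) (k : Fin n) (e : E) :
    contractBar (Pi.single k 1) (wedgeMonomialSmul K e) = ∑ a with K a = Sum.inr k,
      wedgeMonomialSmul (K ∘ a.succAbove) ((-1 : ℂ) ^ (a : ℕ) • e) := by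
  ext v
  calc
    _ = (∑ a : Fin (p + 1), (-1) ^ (a : ℕ) *
          antilinearPart (coordCovector (K a)) (Pi.single k 1) *
            wedgeMonomial (K ∘ a.succAbove) v) • e := by
      simp only [contractBar_apply, wedgeMonomialSmul_apply, wedgeMonomial_cons_apply,
        antilinearPart_apply, smul_smul, ← add_smul, Finset.mul_sum, ← Finset.sum_add_distrib,
        smul_eq_mul]
      refine congrArg (· • e) (Finset.sum_congr rfl fun a _ => ?_)
      ring
    _ = _ := by
      simp only [antilinearPart_coordCovector_single, mul_ite, mul_one, mul_zero, ite_mul, zero_mul,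
        ← Finset.sum_filter, Finset.sum_smul, ContinuousAlternatingMap.sum_apply,
        wedgeMonomialSmul_apply, smul_smul, mul_comm (wedgeMonomial _ v)]

theorem comp_succAbove_mem_bidegreeIndices {K : Fin (p + 1) → Fin n ⊕ Fin n}
    (hK : K ∈ bidegreeIndices n (p + 1) r (s + 1)) {a : Fin (p + 1)} {k : Fin n}
    (ha : K a = Sum.inr k) : K ∘ a.succAbove ∈ bidegreeIndices n p r s := by
  simp only [bidegreeIndices, Finset.mem_filter, Finset.mem_univ, true_and, Finset.card_filter,
    Fin.sum_univ_succAbove _ a, ha, Sum.isLeft_inr, Sum.isRight_inr, Bool.false_eq_true, if_false,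
    if_true, zero_add, add_comm 1, Nat.add_right_cancel_iff] at hK
  simpa only [bidegreeIndices, Finset.mem_filter, Finset.mem_univ, true_and, Finset.card_filter]

theorem IsPureForm.contractBar {η : (Fin n → ℂ) → (Fin n → ℂ) [⋀^Fin (p + 1)]→L[ℝ] E}
    (h : IsPureForm r (s + 1) U η) (k : Fin n) :
    IsPureForm r s U (fun x => contractBar (Pi.single k 1) (η x)) := by
  obtain ⟨f, hf, hη⟩ := isPureForm_iff_exists_coeff.1 h
  have pure_sum : IsPureForm r s U (∑ K ∈ bidegreeIndices n (p + 1) r (s + 1),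
      ∑ a with K a = Sum.inr k,
        fun x => wedgeMonomialSmul (K ∘ a.succAbove) ((-1 : ℂ) ^ (a : ℕ) • f x K)) :=
    .sum fun K hK => .sum fun a ha => isPureForm_wedgeMonomialSmul
      (comp_succAbove_mem_bidegreeIndices hK (Finset.mem_filter.1 ha).2)
      ((contDiffOn_pi.1 hf K).const_smul _)
  refine pure_sum.congr fun x hx => ?_
  simp only [hη x hx, pureFormOfCoeff_apply, map_sum, contractBar_wedgeMonomialSmul,
    Finset.sum_apply]

theorem map_complex_smul_of_forall_mem_formsLinearAlong
    {α : (Fin n → ℂ) [⋀^Fin p]→L[ℝ] E} (h : ∀ j, α ∈ formsLinearAlong (Pi.single j 1))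
    (c : ℂ) (v : Fin p → Fin n → ℂ) : α (c • v) = c ^ p • α v := by
  have slot_linear [inst : DecidableEq (Fin p)] (v : Fin p → Fin n → ℂ) (i : Fin p) (c : ℂ)
      (w : Fin n → ℂ) :
      α (Function.update v i (c • w)) = c • α (Function.update v i w) := by
    let L : (Fin n → ℂ) →L[ℝ] E := α.toContinuousMultilinearMap.toContinuousLinearMap v i
    have hL : antilinearPart L = 0 := by
      ext w
      rw [antilinearPart_apply_eq_sum]
      refine Finset.sum_eq_zero fun j _ => ?_
      rw [antilinearPart_apply_eq_zero_iff.2, smul_zero]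
      obtain rfl := Subsingleton.elim inst (instDecidableEqFin p)
      exact h j v i
    exact map_complex_smul_of_antilinearPart_eq_zero hL c w
  let complexMultilinear : MultilinearMap ℂ (fun _ : Fin p => Fin n → ℂ) E :=
    { toFun := α
      map_update_add' := α.map_update_add
      map_update_smul' := slot_linear }
  have := complexMultilinear.map_smul_univ (fun _ => c) v
  rwa [Finset.prod_const, Finset.card_univ, Fintype.card_fin] at this

theorem wedgeMonomial_complex_smul {K : Fin p → Fin n ⊕ Fin n} (hK : K ∈ bidegreeIndices n p r s)
    (c : ℂ) (v : Fin p → Fin n → ℂ) :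
    wedgeMonomial K (c • v) = c ^ r * (starRingEnd ℂ) c ^ s * wedgeMonomial K v := by
  let factor : Fin n ⊕ Fin n → ℂ := Sum.elim (fun _ => c) (fun _ => (starRingEnd ℂ) c)
  have coord_smul (k : Fin n ⊕ Fin n) (w : Fin n → ℂ) :
      coordCovector k (c • w) = factor k * coordCovector k w := by
    cases k
    exacts [rfl, map_mul (starRingEnd ℂ) _ _]
  have prod_factor : ∏ a, factor (K a) = c ^ r * (starRingEnd ℂ) c ^ s := by
    obtain ⟨-, rfl, rfl⟩ := Finset.mem_filter.1 hK
    simp only [← Finset.prod_const, Finset.prod_filter, ← Finset.prod_mul_distrib]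
    refine Finset.prod_congr rfl fun a _ => ?_
    rcases K a with i | i <;> simp [factor]
  rw [← prod_factor, wedgeMonomial_apply, wedgeMonomial_apply, ← Matrix.det_mul_column]
  simp only [Pi.smul_apply, coord_smul, Matrix.of_apply]

theorem pureFormOfCoeff_eq_zero (hp : r + s = p) (hs : s ≠ 0)
    {c : (Fin p → Fin n ⊕ Fin n) → E}
    (h : ∀ j, pureFormOfCoeff n p E r s c ∈ formsLinearAlong (Pi.single j 1)) :
    pureFormOfCoeff n p E r s c = 0 := by
  ext v
  obtain ⟨z, hz⟩ := IsAlgClosed.exists_pow_nat_eq Complex.I (Nat.pos_of_ne_zero hs)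
  have hz_conj : (starRingEnd ℂ) z ^ s = -Complex.I := by rw [← map_pow, hz, Complex.conj_I]
  have hz0 : z ≠ 0 := by
    rintro rfl
    exact Complex.I_ne_zero (hz.symm.trans (zero_pow hs))
  have scale_linear := map_complex_smul_of_forall_mem_formsLinearAlong h z v
  have scale_pure : pureFormOfCoeff n p E r s c (z • v) =
      (z ^ r * (starRingEnd ℂ) z ^ s) • pureFormOfCoeff n p E r s c v := by
    simp only [pureFormOfCoeff_apply_apply, Finset.smul_sum, smul_smul]
    exact Finset.sum_congr rfl fun K hK => by rw [wedgeMonomial_complex_smul hK]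
  have z_pow : z ^ p = z ^ r * Complex.I := by rw [← hp, pow_add, hz]
  rw [scale_pure, z_pow, hz_conj, ← sub_eq_zero, ← sub_smul] at scale_linear
  refine (smul_eq_zero.1 scale_linear).resolve_left ?_
  rw [show z ^ r * -Complex.I - z ^ r * Complex.I = -(2 * z ^ r * Complex.I) by ring, neg_eq_zero]
  exact mul_ne_zero (mul_ne_zero two_ne_zero (pow_ne_zero r hz0)) Complex.I_ne_zero

end PureForms

section CauchyPompeiu

open MeasureTheory Set

section Real

variable {F : Type*} [NormedAddCommGroup F] [NormedSpace ℝ F]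

theorem integral_Ioi_fderiv_smul {V : Type*} [NormedAddCommGroup V] [NormedSpace ℝ V]
    [CompleteSpace F] {h : V → F} (hh : ContDiff ℝ 1 h) (hc : HasCompactSupport h) {v : V}
    (hv : v ≠ 0) : ∫ r in Ioi (0 : ℝ), fderiv ℝ h (r • v) v = -h 0 := by
  have hd (r : ℝ) : HasDerivAt (fun r : ℝ => h (r • v)) (fderiv ℝ h (r • v) v) r := by
    have := (hasDerivAt_id r).smul_const v
    rw [one_smul] at this
    exact (hh.differentiable one_ne_zero _).hasFDerivAt.comp_hasDerivAt r this
  have contDiff_line : ContDiff ℝ 1 fun r : ℝ => h (r • v) :=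
    hh.comp (contDiff_id.smul contDiff_const)
  have hcv : HasCompactSupport fun r : ℝ => h (r • v) :=
    hc.comp_isClosedEmbedding (isClosedEmbedding_smul_left hv)
  simpa only [(hd _).deriv, zero_smul] using hcv.integral_Ioi_deriv_eq contDiff_line 0

theorem integral_fderiv_circle [CompleteSpace F] {h : ℂ → F} (hh : ContDiff ℝ 1 h) {r : ℝ}
    (hr : r ≠ 0) :
    ∫ θ in Ioo (-Real.pi) Real.pi, fderiv ℝ h (r • Complex.exp (θ * Complex.I))
      (Complex.I * Complex.exp (θ * Complex.I)) = 0 := by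
  have hasDerivAt_exp (θ : ℝ) : HasDerivAt (fun t : ℝ => Complex.exp (t * Complex.I))
      (Complex.I * Complex.exp (θ * Complex.I)) θ := by
    have := (Complex.ofRealCLM.hasDerivAt (x := θ)).mul_const Complex.I
    rw [Complex.ofRealCLM_apply, Complex.ofReal_one, one_mul] at this
    rw [mul_comm Complex.I]
    exact this.cexp
  have hd (θ : ℝ) : HasDerivAt (fun θ : ℝ => r⁻¹ • h (r • Complex.exp (θ * Complex.I)))
      (fderiv ℝ h (r • Complex.exp (θ * Complex.I)) (Complex.I * Complex.exp (θ * Complex.I)))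
      θ := by
    have := ((hh.differentiable one_ne_zero _).hasFDerivAt.comp_hasDerivAt θ
      ((hasDerivAt_exp θ).const_smul r)).const_smul r⁻¹
    rwa [map_smul, inv_smul_smul₀ hr] at this
  have cont_deriv : Continuous fun θ : ℝ => fderiv ℝ h (r • Complex.exp (θ * Complex.I))
      (Complex.I * Complex.exp (θ * Complex.I)) :=
    ((hh.continuous_fderiv one_ne_zero).comp (by fun_prop)).clm_apply (by fun_prop)
  rw [← integral_Ioc_eq_integral_Ioo,
    ← intervalIntegral.integral_of_le (neg_le_self Real.pi_pos.le),
    intervalIntegral.integral_eq_sub_of_hasDerivAt (fun θ _ => hd θ)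
      (cont_deriv.intervalIntegrable _ _)]
  simp only [Complex.ofReal_neg, neg_mul, Complex.exp_neg, Complex.exp_pi_mul_I, inv_neg, inv_one,
    sub_self]

theorem integrableOn_polarCoord_target {D : ℂ → ℂ →L[ℝ] F} (hD : Continuous D)
    (hc : HasCompactSupport D) {u : ℝ → ℂ} (hu : Continuous u) :
    IntegrableOn (fun q : ℝ × ℝ => D (q.1 • Complex.exp (q.2 * Complex.I)) (u q.2))
      polarCoord.target := by
  obtain ⟨R, hR⟩ := hc.isCompact.isBounded.subset_closedBall 0
  have hcont : Continuous fun q : ℝ × ℝ => D (q.1 • Complex.exp (q.2 * Complex.I)) (u q.2) :=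
    (hD.comp (by fun_prop)).clm_apply (by fun_prop)
  refine IntegrableOn.of_forall_sdiff_eq_zero (s := Icc 0 R ×ˢ Icc (-Real.pi) Real.pi)
    (hcont.continuousOn.integrableOn_compact (isCompact_Icc.prod isCompact_Icc))
    polarCoord.open_target.measurableSet ?_
  rintro q ⟨⟨hq_pos, hq_angle⟩, hq⟩
  have hRq : R < q.1 := by
    by_contra! hqR
    exact hq ⟨⟨le_of_lt hq_pos, hqR⟩, Ioo_subset_Icc_self hq_angle⟩
  have hD0 : D (q.1 • Complex.exp (q.2 * Complex.I)) = 0 := by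
    refine image_eq_zero_of_notMem_tsupport fun hmem => ?_
    have := hR hmem
    rw [mem_closedBall_zero_iff, norm_smul, Complex.norm_exp_ofReal_mul_I, mul_one] at this
    exact hRq.not_ge ((le_abs_self _).trans this)
  rw [hD0, zero_apply]

theorem integral_polarCoord_target_fderiv_radial [CompleteSpace F] {h : ℂ → F}
    (hh : ContDiff ℝ 1 h) (hc : HasCompactSupport h) :
    ∫ q in polarCoord.target, fderiv ℝ h (q.1 • Complex.exp (q.2 * Complex.I))
      (Complex.exp (q.2 * Complex.I)) = -(2 * Real.pi) • h 0 := by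
  have hint := integrableOn_polarCoord_target (hh.continuous_fderiv one_ne_zero) (hc.fderiv ℝ)
    (u := fun θ => Complex.exp (θ * Complex.I)) (by fun_prop)
  rw [polarCoord_target, Measure.volume_eq_prod] at *
  rw [← setIntegral_prod_swap]
  refine (setIntegral_prod _ hint.swap).trans ?_
  simp only [Function.comp_apply, Prod.fst_swap, Prod.snd_swap,
    integral_Ioi_fderiv_smul hh hc (Complex.exp_ne_zero _)]
  rw [setIntegral_const, Real.volume_real_Ioo_of_le (neg_le_self Real.pi_pos.le)]
  module

theorem integral_polarCoord_target_fderiv_angular [CompleteSpace F] {h : ℂ → F}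
    (hh : ContDiff ℝ 1 h) (hc : HasCompactSupport h) :
    ∫ q in polarCoord.target, fderiv ℝ h (q.1 • Complex.exp (q.2 * Complex.I))
      (Complex.I * Complex.exp (q.2 * Complex.I)) = 0 := by
  have hint := integrableOn_polarCoord_target (hh.continuous_fderiv one_ne_zero) (hc.fderiv ℝ)
    (u := fun θ => Complex.I * Complex.exp (θ * Complex.I)) (by fun_prop)
  rw [polarCoord_target, Measure.volume_eq_prod] at *
  rw [setIntegral_prod _ hint]
  exact setIntegral_eq_zero_of_forall_eq_zero fun r hr => integral_fderiv_circle hh (ne_of_gt hr)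

end Real

variable {F : Type*} [NormedAddCommGroup F] [NormedSpace ℂ F]

theorem smul_inv_smul_antilinearPart_one (L : ℂ →L[ℝ] F) {r : ℝ} (hr : r ≠ 0) {u : ℂ}
    (hu : ‖u‖ = 1) : r • (r • u)⁻¹ • antilinearPart L 1 = antilinearPart L u := by
  have inv_eq_conj : u⁻¹ = (starRingEnd ℂ) u := by
    rw [Complex.inv_def, Complex.normSq_eq_norm_sq, hu, one_pow, inv_one, Complex.ofReal_one,
      mul_one]
  rw [smul_inv₀, inv_eq_conj, ← smul_assoc, smul_inv_smul₀ hr, ← antilinearPart_smul, smul_eq_mul,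
    mul_one]

/-- In polar coordinates the kernel `z⁻¹` cancels against the Jacobian, leaving radial and angular
derivatives; the former integrate to the value at the centre and the latter to zero. -/
theorem integral_inv_smul_conjDeriv_one [CompleteSpace F] {h : ℂ → F} (hh : ContDiff ℝ 1 h)
    (hc : HasCompactSupport h) : ∫ z, z⁻¹ • conjDeriv 1 h z = (-Real.pi : ℂ) • h 0 := by
  have integrable_radial := integrableOn_polarCoord_target (hh.continuous_fderiv one_ne_zero)
    (hc.fderiv ℝ) (u := fun θ => Complex.exp (θ * Complex.I)) (by fun_prop)
  have integrable_angular := integrableOn_polarCoord_target (hh.continuous_fderiv one_ne_zero)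
    (hc.fderiv ℝ) (u := fun θ => Complex.I * Complex.exp (θ * Complex.I)) (by fun_prop)
  have polar (q : ℝ × ℝ) (hq : q ∈ polarCoord.target) :
      q.1 • (Complex.polarCoord.symm q)⁻¹ • conjDeriv 1 h (Complex.polarCoord.symm q) =
        (1 / 2 : ℂ) • (fderiv ℝ h (q.1 • Complex.exp (q.2 * Complex.I))
          (Complex.exp (q.2 * Complex.I)) + Complex.I •
            fderiv ℝ h (q.1 • Complex.exp (q.2 * Complex.I))
              (Complex.I * Complex.exp (q.2 * Complex.I))) := by
    have symm_eq : Complex.polarCoord.symm q = q.1 • Complex.exp (q.2 * Complex.I) := by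
      rw [Complex.polarCoord_symm_apply, Complex.ofReal_cos, Complex.ofReal_sin,
        ← Complex.exp_mul_I, Complex.real_smul]
    rw [symm_eq]
    exact smul_inv_smul_antilinearPart_one _ (ne_of_gt hq.1) (Complex.norm_exp_ofReal_mul_I _)
  rw [← Complex.integral_comp_polarCoord_symm,
    setIntegral_congr_fun polarCoord.open_target.measurableSet polar, integral_smul,
    integral_add integrable_radial (integrable_angular.fun_smul _), integral_smul,
    integral_polarCoord_target_fderiv_radial hh hc,
    integral_polarCoord_target_fderiv_angular hh hc, ← Complex.coe_smul]
  push_cast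
  module

end CauchyPompeiu

section CauchyTransform

open MeasureTheory Set

variable {V F : Type*} [NormedAddCommGroup V] [NormedSpace ℂ V] [NormedAddCommGroup F]
  [NormedSpace ℂ F]

/-- The Cauchy transform of `g` along the complex lines of direction `w`, a solution `u` of
`conjDeriv w u = g` if `g` is smooth with compact support and `w ≠ 0`. The kernel takes the junk
value `0` at `ζ = 0`. -/
noncomputable def cauchyTransform (w : V) (g : V → F) (z : V) : F :=
  ∫ ζ : ℂ, (Real.pi * ζ)⁻¹ • g (z - ζ • w)

theorem locallyIntegrable_pi_mul_inv : LocallyIntegrable fun ζ : ℂ => (Real.pi * ζ)⁻¹ := by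
  refine locallyIntegrable_of_norm_le_rpow (C := Real.pi⁻¹) (α := 1)
    (by simp) (by simp) (.of_forall fun ζ => ?_)
    (measurable_id.const_mul _).inv.aestronglyMeasurable
  rw [Real.rpow_neg_one, norm_inv, norm_mul, mul_inv, Complex.norm_real,
    Real.norm_of_nonneg Real.pi_pos.le]

theorem exists_forall_sub_smul_notMem {s : Set V} (hs : Bornology.IsBounded s) {w : V}
    (hw : w ≠ 0) (M : ℝ) :
    ∃ R : ℝ, ∀ z ∈ Metric.ball 0 M, ∀ ζ ∉ Metric.closedBall (0 : ℂ) R, z - ζ • w ∉ s := by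
  obtain ⟨C, hC⟩ := hs.subset_closedBall 0
  refine ⟨(C + M) / ‖w‖, fun z hz ζ hζ hmem => ?_⟩
  rw [mem_closedBall_zero_iff, not_le, div_lt_iff₀ (norm_pos_iff.2 hw), ← norm_smul] at hζ
  have := norm_sub_norm_le (ζ • w) z
  rw [norm_sub_rev] at this
  linarith [mem_ball_zero_iff.1 hz, mem_closedBall_zero_iff.1 (hC hmem)]

theorem integrable_pi_mul_inv_smul_comp {g : V → F} (hg : Continuous g) (hc : HasCompactSupport g)
    {w : V} (hw : w ≠ 0) (z : V) : Integrable fun ζ : ℂ => (Real.pi * ζ)⁻¹ • g (z - ζ • w) :=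
  locallyIntegrable_pi_mul_inv.integrable_smul_right_of_hasCompactSupport (hg.comp (by fun_prop))
    (hc.comp_isClosedEmbedding
      ((Homeomorph.subLeft z).isClosedEmbedding.comp (isClosedEmbedding_smul_left hw)))

theorem clm_cauchyTransform {G : Type*} [NormedAddCommGroup G] [NormedSpace ℂ G] [CompleteSpace F]
    [CompleteSpace G] (A : F →L[ℂ] G) {g : V → F} (hg : Continuous g) (hc : HasCompactSupport g)
    {w : V} (hw : w ≠ 0) (z : V) :
    A (cauchyTransform w g z) = cauchyTransform w (fun y => A (g y)) z := by
  rw [cauchyTransform, ← A.integral_comp_comm (integrable_pi_mul_inv_smul_comp hg hc hw z)]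
  simp only [map_smul, cauchyTransform]

theorem contDiff_cauchyTransform {m : ℕ∞} {g : V → F} (hg : ContDiff ℝ m g)
    (hc : HasCompactSupport g) {w : V} (hw : w ≠ 0) : ContDiff ℝ m (cauchyTransform w g) := by
  refine contDiff_iff_contDiffAt.2 fun z => ?_
  obtain ⟨R, hR⟩ := exists_forall_sub_smul_notMem hc.isCompact.isBounded hw (‖z‖ + 1)
  have smooth_translate : ContDiff ℝ m ↿fun (y : V) (ζ : ℂ) => g (y + ζ • w) :=
    hg.comp (contDiff_fst.add (contDiff_snd.smul contDiff_const))
  have translate_eq_zero (y : V) (ζ : ℂ) (hy : y ∈ Metric.ball 0 (‖z‖ + 1))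
      (hζ : ζ ∉ Metric.closedBall 0 R) : g (y + ζ • w) = 0 := by
    rw [← sub_neg_eq_add, ← neg_smul]
    refine image_eq_zero_of_notMem_tsupport (hR y hy (-ζ) ?_)
    rwa [mem_closedBall_zero_iff, norm_neg, ← mem_closedBall_zero_iff]
  have smooth_convolution := contDiffOn_convolution_right_with_param_comp (μ := volume)
    (ContinuousLinearMap.lsmul ℝ ℂ : ℂ →L[ℝ] F →L[ℝ] F) (v := fun _ : V => (0 : ℂ))
    contDiffOn_const Metric.isOpen_ball (isCompact_closedBall 0 R) translate_eq_zero
    locallyIntegrable_pi_mul_inv smooth_translate.contDiffOn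
  refine (smooth_convolution.congr fun y _ => ?_).contDiffAt
    (Metric.isOpen_ball.mem_nhds (mem_ball_zero_iff.2 (lt_add_one ‖z‖)))
  simp only [cauchyTransform, convolution_def, ContinuousLinearMap.lsmul_apply, zero_sub,
    neg_smul, ← sub_eq_add_neg]

theorem hasFDerivAt_cauchyTransform {g : V → F} (hg : ContDiff ℝ 1 g)
    (hc : HasCompactSupport g) {w : V} (hw : w ≠ 0) (z : V) :
    HasFDerivAt (cauchyTransform w g) (cauchyTransform w (fderiv ℝ g) z) z := by
  have cont_fderiv : Continuous (fderiv ℝ g) := hg.continuous_fderiv one_ne_zero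
  obtain ⟨C, hC⟩ := (hc.fderiv ℝ).exists_bound_of_continuous cont_fderiv
  obtain ⟨R, hR⟩ :=
    exists_forall_sub_smul_notMem (hc.fderiv ℝ).isCompact.isBounded hw (‖z‖ + 1)
  have bound_integrable : Integrable
      ((Metric.closedBall (0 : ℂ) R).indicator fun ζ => ‖(Real.pi * ζ)⁻¹‖ * C) :=
    IntegrableOn.integrable_indicator
      ((locallyIntegrable_pi_mul_inv.integrableOn_isCompact
        (isCompact_closedBall 0 R)).norm.mul_const C)
      Metric.isClosed_closedBall.measurableSet
  refine hasFDerivAt_integral_of_dominated_of_fderiv_le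
    (F' := fun y (ζ : ℂ) => (Real.pi * ζ)⁻¹ • fderiv ℝ g (y - ζ • w))
    (Metric.isOpen_ball.mem_nhds (mem_ball_zero_iff.2 (lt_add_one ‖z‖)))
    (.of_forall fun y => (integrable_pi_mul_inv_smul_comp hg.continuous hc hw y).1)
    (integrable_pi_mul_inv_smul_comp hg.continuous hc hw z)
    (integrable_pi_mul_inv_smul_comp cont_fderiv (hc.fderiv ℝ) hw z).1
    (.of_forall fun ζ y hy => ?_) bound_integrable (.of_forall fun ζ y _ => ?_)
  · by_cases hζ : ζ ∈ Metric.closedBall 0 R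
    · rw [indicator_of_mem hζ, norm_smul]
      gcongr
      exact hC _
    · rw [indicator_of_notMem hζ, image_eq_zero_of_notMem_tsupport (hR y hy ζ hζ), smul_zero,
        norm_zero]
  · exact ((hg.differentiable one_ne_zero _).hasFDerivAt.comp y
      ((hasFDerivAt_id y).sub_const _)).const_smul _

theorem conjDeriv_cauchyTransform [CompleteSpace F] {g : V → F} (hg : ContDiff ℝ 1 g)
    (hc : HasCompactSupport g) {w : V} (hw : w ≠ 0) (v z : V) :
    conjDeriv v (cauchyTransform w g) z = cauchyTransform w (conjDeriv v g) z := by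
  have cont_fderiv : Continuous (fderiv ℝ g) := hg.continuous_fderiv one_ne_zero
  rw [conjDeriv, (hasFDerivAt_cauchyTransform hg hc hw z).fderiv, ← antilinearPartCLM_apply,
    clm_cauchyTransform _ cont_fderiv (hc.fderiv ℝ) hw]
  exact ContinuousLinearMap.integral_apply (integrable_pi_mul_inv_smul_comp
    ((antilinearPartCLM V F).continuous.comp cont_fderiv)
    ((hc.fderiv ℝ).comp_left (map_zero _)) hw z) v

theorem conjDeriv_one_comp_add_smul {g : V → F} (z w : V) {ζ : ℂ}
    (hg : DifferentiableAt ℝ g (z + ζ • w)) :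
    conjDeriv 1 (fun ζ : ℂ => g (z + ζ • w)) ζ = conjDeriv w g (z + ζ • w) := by
  have line_deriv : HasFDerivAt (fun ζ : ℂ => z + ζ • w)
      ((ContinuousLinearMap.id ℝ ℂ).smulRight w) ζ :=
    ((hasFDerivAt_id ζ).smul_const w).const_add z
  have hd : fderiv ℝ (fun ζ : ℂ => g (z + ζ • w)) ζ =
      (fderiv ℝ g (z + ζ • w)).comp ((ContinuousLinearMap.id ℝ ℂ).smulRight w) :=
    (hg.hasFDerivAt.comp ζ line_deriv).fderiv
  simp only [conjDeriv, antilinearPart_apply, hd, ContinuousLinearMap.comp_apply,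
    ContinuousLinearMap.smulRight_apply, ContinuousLinearMap.id_apply, one_smul, smul_assoc]

theorem cauchyTransform_conjDeriv_self [CompleteSpace F] {g : V → F} (hg : ContDiff ℝ 1 g)
    (hc : HasCompactSupport g) {w : V} (hw : w ≠ 0) (z : V) :
    cauchyTransform w (conjDeriv w g) z = g z := by
  have smooth_line : ContDiff ℝ 1 fun ζ : ℂ => g (z + ζ • w) :=
    hg.comp (contDiff_const.add (contDiff_id.smul contDiff_const))
  have compact_line : HasCompactSupport fun ζ : ℂ => g (z + ζ • w) :=
    hc.comp_isClosedEmbedding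
      ((Homeomorph.addLeft z).isClosedEmbedding.comp (isClosedEmbedding_smul_left hw))
  have cauchy_pompeiu := integral_inv_smul_conjDeriv_one smooth_line compact_line
  simp only [conjDeriv_one_comp_add_smul z w (hg.differentiable one_ne_zero _), zero_smul,
    add_zero] at cauchy_pompeiu
  have pi_ne_zero : (Real.pi : ℂ) ≠ 0 := Complex.ofReal_ne_zero.2 Real.pi_ne_zero
  calc cauchyTransform w (conjDeriv w g) z
    _ = ∫ ζ : ℂ, (-(Real.pi : ℂ)⁻¹) • ζ⁻¹ • conjDeriv w g (z + ζ • w) := by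
      rw [cauchyTransform, ← integral_neg_eq_self]
      simp only [neg_smul, sub_neg_eq_add, neg_mul, smul_smul, mul_neg, inv_neg, mul_inv]
    _ = g z := by
      rw [integral_smul, cauchy_pompeiu, smul_smul, neg_mul_neg, inv_mul_cancel₀ pi_ne_zero,
        one_smul]

theorem cauchyTransform_mem_formsLinearAlong [CompleteSpace F] {p : ℕ} {u w : V} (hw : w ≠ 0)
    {g : V → V [⋀^Fin p]→L[ℝ] F} (hg : Continuous g) (hc : HasCompactSupport g)
    (h : ∀ y, g y ∈ formsLinearAlong u) (z : V) : cauchyTransform w g z ∈ formsLinearAlong u := by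
  cases p with
  | zero => exact fun _ i => i.elim0
  | succ p =>
    rw [← contractBar_eq_zero_iff, clm_cauchyTransform _ hg hc hw]
    simp only [contractBar_eq_zero_iff.2 (h _), cauchyTransform, smul_zero, integral_zero]

theorem isPureForm_cauchyTransform {n p r s : ℕ} [CompleteSpace F] {w : Fin n → ℂ} (hw : w ≠ 0)
    {f : (Fin n → ℂ) → (Fin p → Fin n ⊕ Fin n) → F} (hf : ContDiff ℝ ∞ f)
    (hc : HasCompactSupport f) (U : Set (Fin n → ℂ)) :
    IsPureForm r s U (cauchyTransform w fun y => pureFormOfCoeff n p F r s (f y)) :=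
  isPureForm_iff_exists_coeff.2 ⟨cauchyTransform w f,
    (contDiff_cauchyTransform hf hc hw).contDiffOn,
    fun z _ => (clm_cauchyTransform _ hf.continuous hc hw z).symm⟩

end CauchyTransform

section PolydiscCutoff

open Metric

variable {ι V : Type*} [Fintype ι] [NormedAddCommGroup V] [NormedSpace ℝ V] {x : ι → V}

/-- The product of bump functions in the single coordinates, a bump function on a polydisc. It is
constant in the direction of each coordinate as long as that coordinate stays in the inner disc,
whatever the other coordinates are. -/
noncomputable def prodBump [HasContDiffBump V] (β : ∀ i, ContDiffBump (x i)) (z : ι → V) : ℝ :=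
  ∏ i, β i (z i)

theorem contDiff_prodBump [HasContDiffBump V] {m : ℕ∞} (β : ∀ i, ContDiffBump (x i)) :
    ContDiff ℝ m (prodBump β) :=
  contDiff_prod fun i _ => (β i).contDiff.comp (contDiff_apply ℝ V i)

theorem prodBump_eq_one [HasContDiffBump V] {β : ∀ i, ContDiffBump (x i)} {z : ι → V}
    (hz : ∀ i, z i ∈ closedBall (x i) (β i).rIn) : prodBump β z = 1 :=
  Finset.prod_eq_one fun i _ => (β i).one_of_mem_closedBall (hz i)

theorem tsupport_prodBump_subset [HasContDiffBump V] (β : ∀ i, ContDiffBump (x i)) :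
    tsupport (prodBump β) ⊆ Set.univ.pi fun i => closedBall (x i) (β i).rOut := by
  refine closure_minimal (fun z hz i _ => ?_) (isClosed_set_pi fun _ _ => isClosed_closedBall)
  refine mem_closedBall.2 (not_lt.1 fun hi => hz ?_)
  exact Finset.prod_eq_zero (Finset.mem_univ i) ((β i).zero_of_le_dist hi.le)

theorem fderiv_prodBump_apply_eq_zero [HasContDiffBump V] (β : ∀ i, ContDiffBump (x i))
    {z v : ι → V} (h : ∀ i, v i = 0 ∨ z i ∈ ball (x i) (β i).rIn) :
    fderiv ℝ (prodBump β) z v = 0 := by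
  have eventually_const : ∀ᶠ t : ℝ in nhds 0, prodBump β (z + t • v) = prodBump β z := by
    have factor_const (i : ι) : ∀ᶠ t : ℝ in nhds 0, β i (z i + t • v i) = β i (z i) := by
      rcases h i with hi | hi
      · exact .of_forall fun t => by rw [hi, smul_zero, add_zero]
      · have tendsto_line : Filter.Tendsto (fun t : ℝ => z i + t • v i) (nhds 0) (nhds (z i)) :=
          Continuous.tendsto' (by fun_prop) _ _ (by rw [zero_smul, add_zero])
        filter_upwards [tendsto_line.eventually (isOpen_ball.mem_nhds hi)] with t ht
        rw [(β i).one_of_mem_closedBall (ball_subset_closedBall ht),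
          (β i).one_of_mem_closedBall (ball_subset_closedBall hi)]
    filter_upwards [Filter.eventually_all.2 factor_const] with t ht
    exact Finset.prod_congr rfl fun i _ => ht i
  have smooth : Differentiable ℝ (prodBump β) :=
    (contDiff_prodBump (m := 1) β).differentiable one_ne_zero
  rw [← (smooth z).lineDeriv_eq_fderiv]
  exact (Filter.EventuallyEq.deriv_eq eventually_const).trans (deriv_const _ _)

theorem exists_polydisc_cutoff [FiniteDimensional ℝ V] (x : ι → V) {ρ : ℝ} (hρ : 0 < ρ) :
    ∃ χ : (ι → V) → ℝ, ContDiff ℝ ∞ χ ∧ HasCompactSupport χ ∧ tsupport χ ⊆ ball x ρ ∧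
      (∀ z ∈ ball x (ρ / 2), χ z = 1) ∧
      ∀ z v, (∀ i, v i = 0 ∨ z i ∈ ball (x i) (ρ / 2)) → fderiv ℝ χ z v = 0 := by
  let β (i : ι) : ContDiffBump (x i) := ⟨ρ / 2, 3 / 4 * ρ, half_pos hρ, by linarith⟩
  have tsupport_subset : tsupport (prodBump β) ⊆ closedBall x (3 / 4 * ρ) := by
    rw [closedBall_pi x (by positivity)]
    exact tsupport_prodBump_subset β
  refine ⟨prodBump β, contDiff_prodBump β, .of_isClosed_subset (isCompact_closedBall _ _)
    (isClosed_tsupport _) tsupport_subset, tsupport_subset.trans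
    (closedBall_subset_ball (by linarith)), fun z hz => prodBump_eq_one fun i => ?_,
    fun z v h => fderiv_prodBump_apply_eq_zero β h⟩
  exact mem_closedBall.2 ((dist_le_pi_dist z x i).trans (mem_ball.1 hz).le)

end PolydiscCutoff

section Cutoff

variable {V F : Type*} [NormedAddCommGroup V] [NormedSpace ℂ V] [NormedAddCommGroup F]
  [NormedSpace ℂ F]

theorem contDiff_smul_of_tsupport_subset {m : WithTop ℕ∞} {U : Set V} (hU : IsOpen U) {χ : V → ℝ}
    (hχ : ContDiff ℝ m χ) (hχU : tsupport χ ⊆ U) {f : V → F} (hf : ContDiffOn ℝ m f U) :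
    ContDiff ℝ m fun y => χ y • f y :=
  contMDiff_iff_contDiff.1 <| contMDiff_of_tsupport fun _ hy => contMDiffAt_iff_contDiffAt.2 <|
    hχ.contDiffAt.smul (hf.contDiffAt (hU.mem_nhds (hχU (tsupport_smul_subset_left χ f hy))))

theorem conjDeriv_smul_of_fderiv_eq_zero {χ : V → ℝ} {f : V → F} {w z : V}
    (hχ : DifferentiableAt ℝ χ z) (hf : DifferentiableAt ℝ f z) (hw : fderiv ℝ χ z w = 0)
    (hIw : fderiv ℝ χ z (Complex.I • w) = 0) :
    conjDeriv w (fun y => χ y • f y) z = χ z • conjDeriv w f z := by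
  have fderiv_smul_apply {u : V} (hu : fderiv ℝ χ z u = 0) :
      fderiv ℝ (fun y => χ y • f y) z u = χ z • fderiv ℝ f z u := by
    rw [fderiv_fun_smul hχ hf, add_apply, smul_apply, ContinuousLinearMap.smulRight_apply, hu,
      zero_smul, add_zero]
  rw [conjDeriv, conjDeriv, antilinearPart_apply, antilinearPart_apply, fderiv_smul_apply hw,
    fderiv_smul_apply hIw]
  module

theorem conjDeriv_eq_zero_of_notMem_tsupport {f : V → F} {z : V} (hz : z ∉ tsupport f) (w : V) :
    conjDeriv w f z = 0 := by
  have fderiv_eq_zero : fderiv ℝ f z = 0 :=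
    image_eq_zero_of_notMem_tsupport fun h => hz (tsupport_fderiv_subset ℝ h)
  rw [conjDeriv, fderiv_eq_zero, ← antilinearPartCLM_apply, map_zero, zero_apply]

theorem IsPureForm.exists_cutoff_eq {n p r s : ℕ} {U : Set (Fin n → ℂ)} (hU : IsOpen U)
    {θ : (Fin n → ℂ) → (Fin n → ℂ) [⋀^Fin p]→L[ℝ] F} (hθ : IsPureForm r s U θ)
    {χ : (Fin n → ℂ) → ℝ} (hχ : ContDiff ℝ ∞ χ) (hc : HasCompactSupport χ)
    (hχU : tsupport χ ⊆ U) :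
    ∃ f : (Fin n → ℂ) → (Fin p → Fin n ⊕ Fin n) → F, ContDiff ℝ ∞ f ∧ HasCompactSupport f ∧
      ∀ y, χ y • θ y = pureFormOfCoeff n p F r s (f y) := by
  obtain ⟨f, hf, hθf⟩ := isPureForm_iff_exists_coeff.1 hθ
  refine ⟨fun y => χ y • f y, contDiff_smul_of_tsupport_subset hU hχ hχU hf, hc.smul_right,
    fun y => ?_⟩
  beta_reduce
  by_cases hy : y ∈ U
  · rw [hθf y hy, ContinuousLinearMap.map_smul_of_tower]
  · rw [image_eq_zero_of_notMem_tsupport (fun h => hy (hχU h)), zero_smul, zero_smul, map_zero]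

end Cutoff

section LocalSolution

open Metric

variable {n p r s : ℕ} {E : Type*} [NormedAddCommGroup E] [NormedSpace ℂ E]

theorem IsPureForm.contDiffAt {U : Set (Fin n → ℂ)} (hU : IsOpen U)
    {η : (Fin n → ℂ) → (Fin n → ℂ) [⋀^Fin p]→L[ℝ] E} (hη : IsPureForm r s U η) {m : ℕ∞}
    {x : Fin n → ℂ} (hx : x ∈ U) : ContDiffAt ℝ m η x :=
  (hη.contDiffOn.contDiffAt (hU.mem_nhds hx)).of_le (mod_cast le_top)

theorem IsPureForm.differentiableAt {U : Set (Fin n → ℂ)} (hU : IsOpen U)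
    {η : (Fin n → ℂ) → (Fin n → ℂ) [⋀^Fin p]→L[ℝ] E} (hη : IsPureForm r s U η)
    {x : Fin n → ℂ} (hx : x ∈ U) : DifferentiableAt ℝ η x :=
  (hη.contDiffAt hU (m := 1) hx).differentiableAt one_ne_zero

theorem contractBar_delbar_cauchyTransform [CompleteSpace E] {v w : Fin n → ℂ} (hw : w ≠ 0)
    {g : (Fin n → ℂ) → (Fin n → ℂ) [⋀^Fin p]→L[ℝ] E} (hg : ContDiff ℝ 1 g)
    (hc : HasCompactSupport g) (hv : ∀ y, g y ∈ formsLinearAlong v) (z : Fin n → ℂ) :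
    contractBar v (delbar (cauchyTransform w g) z) = cauchyTransform w (conjDeriv v g) z := by
  rw [contractBar_delbar (hasFDerivAt_cauchyTransform hg hc hw z).differentiableAt
    (.of_forall (cauchyTransform_mem_formsLinearAlong hw hg.continuous hc hv)),
    conjDeriv_cauchyTransform hg hc hw]

theorem conjDeriv_contractBar_eq_zero {η : (Fin n → ℂ) → (Fin n → ℂ) [⋀^Fin (p + 1)]→L[ℝ] E}
    {v x : Fin n → ℂ} (hη : DifferentiableAt ℝ η x) (hclosed : delbar η x = 0)
    (hv : ∀ᶠ y in nhds x, η y ∈ formsLinearAlong v) (w : Fin n → ℂ) :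
    conjDeriv v (fun y => contractBar w (η y)) x = 0 := by
  rw [conjDeriv_clm_comp _ hη, ← contractBar_delbar hη hv, hclosed, map_zero, map_zero]

theorem conjDeriv_cutoff_contractBar_eq_zero {U : Set (Fin n → ℂ)} (hU : IsOpen U)
    {η : (Fin n → ℂ) → (Fin n → ℂ) [⋀^Fin (p + 1)]→L[ℝ] E}
    (hη : ∀ x ∈ U, DifferentiableAt ℝ η x) (hclosed : ∀ x ∈ U, delbar η x = 0)
    {v : Fin n → ℂ} (hv : ∀ x ∈ U, η x ∈ formsLinearAlong v) {χ : (Fin n → ℂ) → ℝ}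
    (hχ : Differentiable ℝ χ) (hχU : tsupport χ ⊆ U) {y : Fin n → ℂ}
    (hχv : fderiv ℝ χ y v = 0) (hχIv : fderiv ℝ χ y (Complex.I • v) = 0) (w : Fin n → ℂ) :
    conjDeriv v (fun x => χ x • contractBar w (η x)) y = 0 := by
  by_cases hy : y ∈ U
  · let A : (Fin n → ℂ) [⋀^Fin (p + 1)]→L[ℝ] E →L[ℝ] (Fin n → ℂ) [⋀^Fin p]→L[ℝ] E :=
      (contractBar w).restrictScalars ℝ
    have diff_contract : DifferentiableAt ℝ (fun x => contractBar w (η x)) y :=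
      A.differentiableAt.comp y (hη y hy)
    rw [conjDeriv_smul_of_fderiv_eq_zero (hχ y) diff_contract hχv hχIv,
      conjDeriv_contractBar_eq_zero (hη y hy) (hclosed y hy)
        ((hU.eventually_mem hy).mono hv), smul_zero]
  · exact conjDeriv_eq_zero_of_notMem_tsupport
      (fun h => hy (hχU (tsupport_smul_subset_left χ _ h))) v

theorem cutoff_contractBar_mem_formsLinearAlong {V F : Type*} [NormedAddCommGroup V]
    [NormedSpace ℂ V] [NormedAddCommGroup F] [NormedSpace ℂ F] {U : Set V}
    {η : V → V [⋀^Fin (p + 1)]→L[ℝ] F} {χ : V → ℝ} (hχU : tsupport χ ⊆ U) {v w : V}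
    (h : v = w ∨ ∀ x ∈ U, η x ∈ formsLinearAlong v) (y : V) :
    χ y • contractBar w (η y) ∈ formsLinearAlong v := by
  by_cases hy : y ∈ U
  · refine Submodule.smul_of_tower_mem _ _ ?_
    rcases h with rfl | h
    exacts [contractBar_self_mem_formsLinearAlong _ _, contractBar_mem_formsLinearAlong (h y hy)]
  · rw [image_eq_zero_of_notMem_tsupport fun h => hy (hχU h), zero_smul]
    exact zero_mem _

/-- The correction is the Cauchy transform along the `k`-th axis of the contraction of `η` with
`∂/∂z̄_k`, cut off. The product form of the cutoff keeps it constant in the directions of `S` on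
the lines parallel to this axis, so that the condition on `S` survives. -/
theorem exists_sub_delbar_mem_formsLinearAlong_insert [CompleteSpace E] {x₀ : Fin n → ℂ}
    {ρ : ℝ} (hρ : 0 < ρ) {η : (Fin n → ℂ) → (Fin n → ℂ) [⋀^Fin (p + 1)]→L[ℝ] E}
    (hη : IsPureForm r (s + 1) (ball x₀ ρ) η) (hclosed : ∀ x ∈ ball x₀ ρ, delbar η x = 0)
    {S : Finset (Fin n)} (hS : ∀ j ∈ S, ∀ x ∈ ball x₀ ρ, η x ∈ formsLinearAlong (Pi.single j 1))
    (k : Fin n) :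
    ∃ ν : (Fin n → ℂ) → (Fin n → ℂ) [⋀^Fin p]→L[ℝ] E, IsPureForm r s (ball x₀ (ρ / 2)) ν ∧
      ∀ j ∈ insert k S, ∀ x ∈ ball x₀ (ρ / 2),
        η x - delbar ν x ∈ formsLinearAlong (Pi.single j 1) := by
  have hk : (Pi.single k 1 : Fin n → ℂ) ≠ 0 := Pi.single_ne_zero_iff.2 one_ne_zero
  obtain ⟨χ, hχ, hχc, hχU, hχ_one, hχ_fderiv⟩ := exists_polydisc_cutoff x₀ hρ
  let g (y : Fin n → ℂ) := χ y • contractBar (Pi.single k 1) (η y)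
  obtain ⟨f, hf, hfc, hgf⟩ := (hη.contractBar k).exists_cutoff_eq isOpen_ball hχ hχc hχU
  have g_eq : g = fun y => pureFormOfCoeff n p E r s (f y) := funext hgf
  have hg : ContDiff ℝ 1 g := (contDiff_smul_of_tsupport_subset isOpen_ball hχ hχU
    (hη.contractBar k).contDiffOn).of_le (mod_cast le_top)
  have hgc : HasCompactSupport g := hχc.smul_right
  have g_mem (j : Fin n) (hj : j = k ∨ j ∈ S) : ∀ y, g y ∈ formsLinearAlong (Pi.single j 1) :=
    cutoff_contractBar_mem_formsLinearAlong hχU (hj.imp (fun h => by rw [h]) (hS j))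
  refine ⟨cauchyTransform (Pi.single k 1) g, g_eq ▸ isPureForm_cauchyTransform hk hf hfc _,
    fun j hj z hz => ?_⟩
  rw [← contractBar_eq_zero_iff, map_sub, contractBar_delbar_cauchyTransform hk hg hgc
    (g_mem j (Finset.mem_insert.1 hj)), sub_eq_zero]
  obtain rfl | hjk := eq_or_ne j k
  · rw [cauchyTransform_conjDeriv_self hg hgc hk]
    simp only [g, hχ_one z hz, one_smul]
  have hjS : ∀ x ∈ ball x₀ ρ, η x ∈ formsLinearAlong (Pi.single j 1) :=
    hS j (Finset.mem_of_mem_insert_of_ne hj hjk)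
  have fderiv_cutoff_line (c ζ : ℂ) :
      fderiv ℝ χ (z - ζ • Pi.single k 1) (c • Pi.single j 1) = 0 := by
    refine hχ_fderiv _ _ fun i => (eq_or_ne i j).symm.imp (fun hij => ?_) fun hij => ?_
    · rw [Pi.smul_apply, Pi.single_eq_of_ne hij, smul_zero]
    · rw [Pi.sub_apply, Pi.smul_apply, Pi.single_eq_of_ne (hij ▸ hjk), smul_zero, sub_zero]
      exact (dist_le_pi_dist z x₀ i).trans_lt hz
  have conjDeriv_line (ζ : ℂ) : conjDeriv (Pi.single j 1) g (z - ζ • Pi.single k 1) = 0 :=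
    conjDeriv_cutoff_contractBar_eq_zero isOpen_ball (fun _ => hη.differentiableAt isOpen_ball)
      hclosed hjS (hχ.differentiable (by simp)) hχU
      (by simpa only [one_smul] using fderiv_cutoff_line 1 ζ) (fderiv_cutoff_line Complex.I ζ) _
  rw [contractBar_eq_zero_iff.2 (hjS z (ball_subset_ball (half_le_self hρ.le) hz))]
  simp only [cauchyTransform, conjDeriv_line, smul_zero, MeasureTheory.integral_zero]

theorem exists_sub_delbar_mem_formsLinearAlong [CompleteSpace E] {x₀ : Fin n → ℂ} {ρ₀ : ℝ}
    (hρ₀ : 0 < ρ₀) {η : (Fin n → ℂ) → (Fin n → ℂ) [⋀^Fin (p + 1)]→L[ℝ] E}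
    (hη : IsPureForm r (s + 1) (ball x₀ ρ₀) η) (hclosed : ∀ x ∈ ball x₀ ρ₀, delbar η x = 0)
    (S : Finset (Fin n)) :
    ∃ ρ > 0, ρ ≤ ρ₀ ∧ ∃ μ : (Fin n → ℂ) → (Fin n → ℂ) [⋀^Fin p]→L[ℝ] E,
      IsPureForm r s (ball x₀ ρ) μ ∧
      ∀ j ∈ S, ∀ x ∈ ball x₀ ρ, η x - delbar μ x ∈ formsLinearAlong (Pi.single j 1) := by
  induction S using Finset.induction_on with
  | empty => exact ⟨ρ₀, hρ₀, le_rfl, 0, .zero, fun j hj => absurd hj (Finset.notMem_empty j)⟩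
  | insert k S _ ih =>
    obtain ⟨ρ, hρ, hρρ₀, μ, hμ, hμS⟩ := ih
    have hηρ : IsPureForm r (s + 1) (ball x₀ ρ) η := hη.mono (ball_subset_ball hρρ₀)
    have hdμ : IsPureForm r (s + 1) (ball x₀ ρ) (delbar μ) := hμ.delbar isOpen_ball
    have sub_closed (x : Fin n → ℂ) (hx : x ∈ ball x₀ ρ) :
        delbar (fun y => η y - delbar μ y) x = 0 := by
      rw [delbar_sub (hηρ.differentiableAt isOpen_ball hx) (hdμ.differentiableAt isOpen_ball hx),
        hclosed x (ball_subset_ball hρρ₀ hx), delbar_delbar (hμ.contDiffAt isOpen_ball (m := 2) hx),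
        sub_zero]
    obtain ⟨ν, hν, hνS⟩ :=
      exists_sub_delbar_mem_formsLinearAlong_insert hρ (hηρ.sub hdμ) sub_closed hμS k
    have hμ_half : IsPureForm r s (ball x₀ (ρ / 2)) μ :=
      hμ.mono (ball_subset_ball (half_le_self hρ.le))
    refine ⟨ρ / 2, half_pos hρ, (half_le_self hρ.le).trans hρρ₀, μ + ν, hμ_half.add hν,
      fun j hj x hx => ?_⟩
    have delbar_add_eq : delbar (μ + ν) x = delbar μ x + delbar ν x :=
      delbar_add (hμ_half.differentiableAt isOpen_ball hx) (hν.differentiableAt isOpen_ball hx)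
    rw [delbar_add_eq, ← sub_sub]
    exact hνS j hj x hx

theorem IsPureForm.eq_zero_of_forall_mem_formsLinearAlong (hp : r + s = p) (hs : s ≠ 0)
    {U : Set (Fin n → ℂ)} {η : (Fin n → ℂ) → (Fin n → ℂ) [⋀^Fin p]→L[ℝ] E}
    (hη : IsPureForm r s U η) {x : Fin n → ℂ} (hx : x ∈ U)
    (h : ∀ j, η x ∈ formsLinearAlong (Pi.single j 1)) : η x = 0 := by
  obtain ⟨f, -, hηf⟩ := isPureForm_iff_exists_coeff.1 hη
  rw [hηf x hx] at h ⊢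
  exact pureFormOfCoeff_eq_zero hp hs h

theorem exists_eq_delbar [CompleteSpace E] (hp : r + (s + 1) = p + 1) {U : Set (Fin n → ℂ)}
    (hU : IsOpen U) {η : (Fin n → ℂ) → (Fin n → ℂ) [⋀^Fin (p + 1)]→L[ℝ] E}
    (hη : IsPureForm r (s + 1) U η) (hclosed : ∀ x ∈ U, delbar η x = 0) {x₀ : Fin n → ℂ}
    (hx₀ : x₀ ∈ U) :
    ∃ W ⊆ U, IsOpen W ∧ x₀ ∈ W ∧ ∃ μ : (Fin n → ℂ) → (Fin n → ℂ) [⋀^Fin p]→L[ℝ] E,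
      IsPureForm r s W μ ∧ ∀ x ∈ W, η x = delbar μ x := by
  obtain ⟨ρ₀, hρ₀, hballU⟩ := isOpen_iff.1 hU x₀ hx₀
  obtain ⟨ρ, hρ, hρρ₀, μ, hμ, hlin⟩ := exists_sub_delbar_mem_formsLinearAlong hρ₀ (hη.mono hballU)
    (fun x hx => hclosed x (hballU hx)) Finset.univ
  have hWU : ball x₀ ρ ⊆ U := (ball_subset_ball hρρ₀).trans hballU
  refine ⟨ball x₀ ρ, hWU, isOpen_ball, mem_ball_self hρ, μ, hμ, fun x hx => sub_eq_zero.1 ?_⟩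
  exact ((hη.mono hWU).sub (hμ.delbar isOpen_ball)).eq_zero_of_forall_mem_formsLinearAlong hp
    s.succ_ne_zero hx fun j => hlin j (Finset.mem_univ j) x hx

end LocalSolution

theorem mainTheorem3 {n p r s : ℕ} {E : Type*} [NormedAddCommGroup E] [NormedSpace ℂ E]
    [CompleteSpace E] (hp : r + s = p + 1) (hs : 1 ≤ s)
    (U : Set (Fin n → ℂ)) (hU : IsOpen U)
    (η : (Fin n → ℂ) → (Fin n → ℂ) [⋀^Fin (p + 1)]→L[ℝ] E) (hη : IsPureForm r s U η) :
    (∀ x ∈ U, delbar η x = 0) ↔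
      ∃ (ι : Type) (W : ι → Set (Fin n → ℂ))
        (μ : ι → (Fin n → ℂ) → (Fin n → ℂ) [⋀^Fin p]→L[ℝ] E),
        (∀ a, IsOpen (W a)) ∧ (⋃ a, W a) = U ∧
        ∀ a, IsPureForm r (s - 1) (W a) (μ a) ∧ ∀ x ∈ W a, η x = delbar (μ a) x := by
  obtain ⟨s, rfl⟩ := Nat.exists_eq_add_of_le' hs
  constructor
  · intro hclosed
    choose W hWU hW hxW μ hμ hημ using fun x : U => exists_eq_delbar hp hU hη hclosed x.2
    refine ⟨U, W, μ, hW, ?_, fun a => ⟨hμ a, hημ a⟩⟩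
    exact (Set.iUnion_subset hWU).antisymm fun x hx => Set.mem_iUnion.2 ⟨⟨x, hx⟩, hxW ⟨x, hx⟩⟩
  · rintro ⟨ι, W, μ, hW, rfl, hμ⟩ x hx
    obtain ⟨a, ha⟩ := Set.mem_iUnion.1 hx
    have eq_near_x : η =ᶠ[nhds x] delbar (μ a) := ((hW a).eventually_mem ha).mono (hμ a).2
    rw [delbar_congr eq_near_x, delbar_delbar ((hμ a).1.contDiffAt (hW a) (m := 2) ha)]
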